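/- **Setting.** Let $x=(v,h)$ range over $\Omega=\{0,1\}^{n_V}\times\{0,1\}^{n_H}$, and for $W=(W',b,a)$ let $E(x;W)=-v^{\mathsf T}W'h-b^{\mathsf T}v-a^{\mathsf T}h$, $Z(W)=\sum_{x}e^{-E(x;W)}$, $p(x;W)=e^{-E(x;W)}/Z(W)$ (a restricted Boltzmann machine). Let $v_1,\dots,v_N$ ($N\ge1$) be visible training examples and $\mathcal L(W)=\frac1N\sum_{n=1}^N\log\sum_h p((v_n,h);W)$ the average log-likelihood. Fix $W$. Let $p_\Phi$ be the transition matrix of an irreducible, time-reversible Markov chain on $\Omega$ with steady state $p(\cdot;W)$, let $\emptyset\ne\mathcal S\subsetneq\Omega$ be a stopping set, and let $Z_{\mathcal S}(W)=\sum_{y\in\mathcal S}e^{-E(y;W)}$. Independent tours $r=1,2,\dots$ are run: $X^{(r)}(1)\in\mathcal S$ is drawn with probability $e^{-E(x;W)}/Z_{\mathcal S}(W)$, the chain then moves according to $p_\Phi$, and the length $\xi^{(r)}$ is the least $k\ge1$ with $X^{(r)}(k+1)\in\mathcal S$. For $R$ tours and $k\ge 1$ let $\mathcal C_k$ be the family of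 those tours $(X(1),\dots,X(k))$ that have length exactly $k$ (counted with multiplicity); only tours with $k\le K$ are completed. Put $\widehat{\mathbb E}[\xi]=\sum_{k=1}^K|\mathcal C_k|\,k\,/\sum_{k=1}^K|\mathcal C_k|$ and, for a learning rate $\eta>0$, $$\widehat\nabla(K,R)=\eta\Bigg(\frac{\widehat{\mathbb E}[\xi]}{N}\sum_{n=1}^N\frac{\partial E(x_n;W)}{\partial W}-\frac{\sum_{k=1}^K\sum_{(X(1),\dots,X(k))\in\mathcal C_k}\sum_{i=1}^k\frac{\partial E(X(i);W)}{\partial W}}{\sum_{k=1}^K|\mathcal C_k|}\Bigg),$$ where $x_n=(v_n,\mathbb E_W[h\mid v_n])$ and $\mathbb E_W[h\mid v_n]$ is held fixed while differentiating (the LVS-$K$ estimator). **Corollary (LVS-$K$: the Las Vegas Slope estimator).** 1. The estimator is consistent for the gradient of the negative log-likelihood, up to the positive factor $Z(W)/Z_{\mathcal S}(W)$: $\mathcal L$ is differentiable at $W$ and, almost surely, as $K,R\to\infty$ jointly, $$\widehat\nabla(K,R)\to-\eta\,\frac{Z(W)}{Z_{\mathcal S}(W)}\,\nabla_W\mathcal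 L(W),\qquad \frac{\widehat\nabla(K,R)}{\widehat{\mathbb E}[\xi]}\to-\eta\,\nabla_W\mathcal L(W).$$ 2. The contribution of the tours of length $k$ to the negative statistics, $\big(\sum_{j=1}^K|\mathcal C_j|\big)^{-1}\sum_{(X(1),\dots,X(k))\in\mathcal C_k}\sum_{i=1}^k\partial E(X(i);W)/\partial W$ (read as $0$ if no tour is completed), is proportional to $$w_k=P[\xi=k]\cdot k\cdot\mathbb E\big[\partial E(\tilde X_k;W)/\partial W\big],$$ where $\tilde X_k$ is a uniformly random state of a tour conditioned to have length $k$: for all $K,R\ge1$ there is a constant $c>0$ such that for every $1\le k\le K$ this contribution is integrable with expectation $c\,w_k$; and for every $k\ge1$ the contribution converges almost surely to $w_k$ as $K,R\to\infty$ jointly. 3. If there is $\epsilon>0$ with $\sum_{y\in\mathcal S}p_\Phi(x,y)\ge\epsilon$ for all $x\in\Omega\setminus\mathcal S$, then $P[\xi=k]\cdot k$ decays exponentially: there are constants $C,c>0$ with $P[\xi=k]\cdot k\le C e^{-ck}$ for all $k\ge1$. -/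

import Mathlib

open MeasureTheory ProbabilityTheory Filter Topology

namespace RBM

noncomputable section

/-! ### Restricted Boltzmann machines -/

/-- States `x = (v, h)` with `v ∈ {0,1}^nV` (visible) and `h ∈ {0,1}^nH` (hidden). -/
abbrev State (nV nH : ℕ) : Type := (Fin nV → Fin 2) × (Fin nH → Fin 2)

/-- Parameters `W = (W', b, a)`, stored as one Euclidean vector, so that gradients in `W` are
Mathlib's `gradient`: one coordinate for each entry of the matrix `W'`, of `b` and of `a`. -/
abbrev Params (nV nH : ℕ) : Type :=
  EuclideanSpace ℝ ((Fin nV × Fin nH) ⊕ (Fin nV ⊕ Fin nH))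

variable {nV nH : ℕ}

/-- The interaction matrix `W'`. -/
def weights (W : Params nV nH) : Matrix (Fin nV) (Fin nH) ℝ :=
  Matrix.of fun i j => W (Sum.inl (i, j))

/-- The visible bias `b`. -/
def visibleBias (W : Params nV nH) : Fin nV → ℝ := fun i => W (Sum.inr (Sum.inl i))

/-- The hidden bias `a`. -/
def hiddenBias (W : Params nV nH) : Fin nH → ℝ := fun j => W (Sum.inr (Sum.inr j))

/-- A binary vector as a real vector. -/
def toReal {n : ℕ} (u : Fin n → Fin 2) : Fin n → ℝ := fun i => ((u i : ℕ) : ℝ)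

/-- The energy `E((v, h); W) = - vᵀ W' h - bᵀ v - aᵀ h`, for real vectors `v` and `h`. -/
def energy (v : Fin nV → ℝ) (h : Fin nH → ℝ) (W : Params nV nH) : ℝ :=
  -(v ⬝ᵥ (weights W).mulVec h) - visibleBias W ⬝ᵥ v - hiddenBias W ⬝ᵥ h

/-- The energy of a state of the machine. -/
def stateEnergy (x : State nV nH) (W : Params nV nH) : ℝ :=
  energy (toReal x.1) (toReal x.2) W

/-- The partition function `Z(W)`. -/
def partition (W : Params nV nH) : ℝ := ∑ x : State nV nH, Real.exp (-stateEnergy x W)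

/-- The model distribution `p(x; W) = exp(-E(x; W)) / Z(W)`. -/
def prob (W : Params nV nH) (x : State nV nH) : ℝ :=
  Real.exp (-stateEnergy x W) / partition W

/-- The conditional distribution `p(h | v; W)`. -/
def condHidden (W : Params nV nH) (v : Fin nV → Fin 2) (h : Fin nH → Fin 2) : ℝ :=
  prob W (v, h) / ∑ h' : Fin nH → Fin 2, prob W (v, h')

/-- The conditional mean `𝔼_W[h | v]`. -/
def meanHidden (W : Params nV nH) (v : Fin nV → Fin 2) : Fin nH → ℝ :=
  ∑ h : Fin nH → Fin 2, condHidden W v h • toReal h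

/-- The average negative log-likelihood `-(1/N) ∑ₙ log ∑_h p((vₙ, h); W)` of training data
`v₁, …, v_N`. -/
def negLogLik {N : ℕ} (data : Fin N → Fin nV → Fin 2) (W : Params nV nH) : ℝ :=
  -((1 / (N : ℝ)) * ∑ n, Real.log (∑ h : Fin nH → Fin 2, prob W (data n, h)))

/-- `∂E(x; W)/∂W` at a state `x`. -/
def energyGrad (W : Params nV nH) (x : State nV nH) : Params nV nH :=
  gradient (stateEnergy x) W

/-- `∂E(xₙ; W)/∂W` at a training example: `xₙ = (vₙ, 𝔼_W[h | vₙ])`, where the hidden mean is held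
fixed while differentiating. -/
def dataEnergyGrad (W : Params nV nH) (v : Fin nV → Fin 2) : Params nV nH :=
  gradient (energy (toReal v) (meanHidden W v)) W

/-! ### The Markov chain and its tours -/

/-- `P` is the transition matrix of an irreducible, time-reversible Markov chain with
steady state `p(·; W)`. -/
structure IsReversibleChain (W : Params nV nH)
    (P : Matrix (State nV nH) (State nV nH) ℝ) : Prop where
  stochastic : P ∈ Matrix.rowStochastic ℝ (State nV nH)
  irreducible : P.IsIrreducible
  detailedBalance : ∀ x y, prob W x * P x y = prob W y * P y x

/-- `Z_S(W) = ∑_{y ∈ S} exp(-E(y; W))`. -/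
def stoppingPartition (W : Params nV nH) (S : Finset (State nV nH)) : ℝ :=
  ∑ y ∈ S, Real.exp (-stateEnergy y W)

/-- The law of the first state of a tour: `x ∈ S` has probability `exp(-E(x; W)) / Z_S(W)`. -/
def startProb (W : Params nV nH) (S : Finset (State nV nH)) (x : State nV nH) : ℝ :=
  if x ∈ S then Real.exp (-stateEnergy x W) / stoppingPartition W S else 0

/-- `X 0, X 1, …` is a Markov chain under `μ` with initial distribution `init` and transition
matrix `P`. -/
structure IsMarkovChain {α Ω : Type*} [MeasurableSpace α] [MeasurableSpace Ω] (μ : Measure Ω)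
    (init : α → ℝ) (P : Matrix α α ℝ) (X : ℕ → Ω → α) : Prop where
  measurable : ∀ t, Measurable (X t)
  law : ∀ (n : ℕ) (x : ℕ → α), μ.real {ω | ∀ t ≤ n, X t ω = x t} =
    init (x 0) * ∏ t ∈ Finset.range n, P (x t) (x (t + 1))

/-- Tours `r = 0, 1, 2, …`, run independently from each other: each is a trajectory of the chain
`P` whose first state is drawn from `S` with probability proportional to `exp(-E)`. Here
`X r t` is the state that is written `X⁽ʳ⁾(t + 1)` with times counted from `1`. -/
structure AreTours {Ω : Type*} [MeasurableSpace Ω] (μ : Measure Ω) (W : Params nV nH)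
    (S : Finset (State nV nH)) (P : Matrix (State nV nH) (State nV nH) ℝ)
    (X : ℕ → ℕ → Ω → State nV nH) : Prop where
  chain : ∀ r, IsMarkovChain μ (startProb W S) P (X r)
  indep : iIndepFun (fun r ω t => X r t ω) μ

/-- The length `ξ` of the tour along the trajectory `x 0, x 1, …`: the least `k ≥ 1` such that
the state after `k` transitions lies in `S` (`⊤` if there is none). -/
def tourLength (S : Finset (State nV nH)) (x : ℕ → State nV nH) : ℕ∞ :=
  ⨅ (k : ℕ) (_ : 1 ≤ k ∧ x k ∈ S), (k : ℕ∞)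

/-- The event `ξ = k` for the trajectory `X`. -/
def lengthEvent {Ω : Type*} (S : Finset (State nV nH)) (X : ℕ → Ω → State nV nH) (k : ℕ) :
    Set Ω :=
  {ω | tourLength S (fun t => X t ω) = k}

/-- The law of a random state `X̃_k` of a tour of length `k`: the tour is conditioned on `ξ = k`,
and independently one of its `k` states is picked uniformly. -/
def tourStateLaw {Ω : Type*} [MeasurableSpace Ω] (μ : Measure Ω) (S : Finset (State nV nH))
    (X : ℕ → Ω → State nV nH) (k : ℕ) : Measure (State nV nH) :=
  ((cond μ (lengthEvent S X k)).prod (uniformOn (Set.Iio k))).map fun q => X q.2 q.1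

/-- `P[ξ = k] · k · 𝔼[∂E(X̃_k; W)/∂W]`. -/
def tourWeight {Ω : Type*} [MeasurableSpace Ω] (μ : Measure Ω) (W : Params nV nH)
    (S : Finset (State nV nH)) (X : ℕ → Ω → State nV nH) (k : ℕ) : Params nV nH :=
  (μ.real (lengthEvent S X k) * k) • ∫ y, energyGrad W y ∂(tourStateLaw μ S X k)

/-! ### The estimator

Below, `x r t` are the realized trajectories of the tours. Only completed tours of length
`k ≤ K` enter, and of these only the states up to the return to `S`. -/

/-- `C_k`: those of the first `R` tours that have length `k`, listed by their index (so that equal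
tours count separately). -/
def toursOfLength (S : Finset (State nV nH)) (x : ℕ → ℕ → State nV nH) (R k : ℕ) : Finset ℕ :=
  open Classical in (Finset.range R).filter fun r => tourLength S (x r) = k

/-- `∑_{k=1}^K |C_k|`. -/
def numCompleted (S : Finset (State nV nH)) (x : ℕ → ℕ → State nV nH) (K R : ℕ) : ℝ :=
  ∑ k ∈ Finset.Icc 1 K, ((toursOfLength S x R k).card : ℝ)

/-- The empirical mean tour length `∑_{k=1}^K |C_k| k / ∑_{k=1}^K |C_k|`. -/
def meanTourLength (S : Finset (State nV nH)) (x : ℕ → ℕ → State nV nH) (K R : ℕ) : ℝ :=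
  (∑ k ∈ Finset.Icc 1 K, ((toursOfLength S x R k).card : ℝ) * k) / numCompleted S x K R

/-- The contribution of the tours of length `k` to the negative statistics. -/
def lengthContribution (W : Params nV nH) (S : Finset (State nV nH))
    (x : ℕ → ℕ → State nV nH) (K R k : ℕ) : Params nV nH :=
  (numCompleted S x K R)⁻¹ •
    ∑ r ∈ toursOfLength S x R k, ∑ i ∈ Finset.range k, energyGrad W (x r i)

/-- The negative statistics: the energy gradients of all states of all completed tours are summed
and divided by the number of completed tours. -/
def negativeStat (W : Params nV nH) (S : Finset (State nV nH))
    (x : ℕ → ℕ → State nV nH) (K R : ℕ) : Params nV nH :=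
  ∑ k ∈ Finset.Icc 1 K, lengthContribution W S x K R k

/-- The LVS-`K` estimator from `R` tours, with learning rate `η`. -/
def lvsEstimator {N : ℕ} (η : ℝ) (data : Fin N → Fin nV → Fin 2) (W : Params nV nH)
    (S : Finset (State nV nH)) (x : ℕ → ℕ → State nV nH) (K R : ℕ) : Params nV nH :=
  η • ((meanTourLength S x K R / N) • (∑ n, dataEnergyGrad W (data n)) - negativeStat W S x K R)

end

end RBM

open RBM

/-!
Write `a t x` for the probability that a tour is still running after `t` transitions and is then
at `x`. This mass satisfies the recursion of the chain killed on its return to `S`. The vector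
`π = exp(-E) / Z_S` is invariant under the chain and agrees with the start distribution on `S`.
The partial sums of `a` over `t` stay below `π`, and the defect `π - ∑ₜ a t` is a nonnegative
invariant vector that vanishes on `S`, so irreducibility forces it to be zero (`hasSum_tabooMass`).
Hence tours end almost surely, and the expected sum of any `f` over the states of a tour is
`∑ₓ π x • f x` (`IsMarkovChain.integral_visitSum`). With `f = 1` this is the expected length
`Z / Z_S`, and with `f = ∂E/∂W` it is `Z / Z_S` times the model expectation of `∂E/∂W`.

The finite-dimensional laws determine the law of the whole trajectory, so the tours are independent
and identically distributed on path space and the strong law of large numbers applies. Restricting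
to tours of length at most `K` leaves the joint limit in `(K, R)` unchanged, because the average
over longer tours is eventually as small as the tail expectation at a fixed `K₀`
(`tendsto_truncated_average`). Since the energy is linear in the parameters and affine in the
hidden vector, the gradient of the negative log-likelihood is the data average minus the model
average of `∂E/∂W` (`hasGradientAt_negLogLik`), which identifies the limit of the estimator.

For finitely many tours, on the event that tour `r` has length `k ≤ K`, the number of completed
tours is one plus the number of other completed tours. The latter is independent of tour `r`, and
its law does not involve `k`, which gives the common factor
(`AreTours.integral_lengthContribution`). Exponential decay holds since the mass `∑ₓ a t x` shrinks
by the factor `1 - ε` in every step after the first.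
-/

namespace RBM

/-! ### Mass of a Markov chain before its return to a set -/

section Taboo

variable {α : Type*} [Fintype α] [DecidableEq α]

/-- The mass at `x` after `t` transitions of the chain with transition matrix `P` that starts from
`init` and is killed as soon as a transition leads into `S`. The initial state is not tested. -/
noncomputable def tabooMass (init : α → ℝ) (P : Matrix α α ℝ) (S : Finset α) : ℕ → α → ℝ
  | 0, x => init x
  | t + 1, x => if x ∈ S then 0 else ∑ y, tabooMass init P S t y * P y x

variable {init : α → ℝ} {P : Matrix α α ℝ} {S : Finset α}

lemma tabooMass_nonneg (hinit : ∀ x, 0 ≤ init x) (hP : ∀ x y, 0 ≤ P x y) (t : ℕ) (x : α) :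
    0 ≤ tabooMass init P S t x := by
  induction t generalizing x with
  | zero => exact hinit x
  | succ t ih =>
    rw [tabooMass]
    split_ifs
    · exact le_rfl
    · exact Finset.sum_nonneg fun y _ => mul_nonneg (ih y) (hP y x)

lemma tabooMass_succ_of_mem {x : α} (hx : x ∈ S) (t : ℕ) :
    tabooMass init P S (t + 1) x = 0 := by
  simp [tabooMass, hx]

/-- A nonnegative invariant vector of an irreducible stochastic matrix vanishes as soon as one of
its entries does. -/
lemma eq_zero_of_invariant_of_apply_eq_zero (hirr : P.IsIrreducible) {d : α → ℝ}
    (hd : ∀ x, 0 ≤ d x) (hinv : ∀ x, ∑ y, d y * P y x = d x) {s : α} (hs : d s = 0) (y : α) :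
    d y = 0 := by
  obtain ⟨n, -, hn⟩ := (Matrix.isIrreducible_iff_exists_pow_pos hirr.nonneg).1 hirr y s
  have hinv' : Matrix.vecMul d P = d := funext fun x => hinv x
  have hpow : ∀ n : ℕ, Matrix.vecMul d (P ^ n) = d := by
    intro n
    induction n with
    | zero => simp
    | succ n ih => rw [pow_succ, ← Matrix.vecMul_vecMul, ih, hinv']
  have h0 : ∑ z, d z * (P ^ n) z s = 0 := by
    rw [← hs]; exact congrFun (hpow n) s
  have hnn : ∀ z ∈ Finset.univ, 0 ≤ d z * (P ^ n) z s := fun z _ =>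
    mul_nonneg (hd z) (Matrix.pow_apply_nonneg hirr.nonneg n z s)
  have := (Finset.sum_eq_zero_iff_of_nonneg hnn).1 h0 y (Finset.mem_univ y)
  exact (mul_eq_zero.1 this).resolve_right hn.ne'

/-- If the chain starts from an invariant vector `π` restricted to `S`, the expected number of
visits to `x` before the return to `S` is `π x`. The defect `π - ∑ₜ (mass at time t)` is
nonnegative, vanishes on `S` and is invariant, hence zero by irreducibility. -/
lemma hasSum_tabooMass (hP : P ∈ Matrix.rowStochastic ℝ α) (hirr : P.IsIrreducible) {π : α → ℝ}
    (hπ : ∀ x, 0 ≤ π x) (hinv : ∀ x, ∑ y, π y * P y x = π x) (hS : S.Nonempty) (x : α) :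
    HasSum (fun t => tabooMass (fun x => if x ∈ S then π x else 0) P S t x) (π x) := by
  set a := tabooMass (fun x => if x ∈ S then π x else 0) P S with ha
  have hP0 := hirr.nonneg
  have ha0 : ∀ t x, 0 ≤ a t x := tabooMass_nonneg (fun x => by split_ifs <;> simp [hπ]) hP0
  have hstep : ∀ n x, ∑ t ∈ Finset.range (n + 1), a t x =
      if x ∈ S then π x else ∑ y, (∑ t ∈ Finset.range n, a t y) * P y x := by
    intro n x
    rw [Finset.sum_range_succ']
    split_ifs with hx
    · simp [ha, tabooMass, hx]
    · simp only [ha, tabooMass, hx, if_false, add_zero, Finset.sum_mul]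
      rw [Finset.sum_comm]
  have hle : ∀ n x, ∑ t ∈ Finset.range n, a t x ≤ π x := by
    intro n
    induction n with
    | zero => simpa using hπ
    | succ n ih =>
      intro x
      rw [hstep]
      split_ifs
      · exact le_rfl
      · rw [← hinv x]
        exact Finset.sum_le_sum fun y _ => mul_le_mul_of_nonneg_right (ih y) (hP0 y x)
  have hsum : ∀ x, Summable fun t => a t x := fun x =>
    summable_of_sum_range_le (fun t => ha0 t x) fun n => hle n x
  set A : α → ℝ := fun x => ∑' t, a t x with hA
  have hlim : ∀ x, Tendsto (fun n => ∑ t ∈ Finset.range n, a t x) atTop (𝓝 (A x)) := fun x =>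
    (hsum x).hasSum.tendsto_sum_nat
  have hAle : ∀ x, A x ≤ π x := fun x => le_of_tendsto' (hlim x) fun n => hle n x
  have hAS : ∀ x ∈ S, A x = π x := by
    intro x hx
    refine tendsto_nhds_unique ((hlim x).comp (tendsto_add_atTop_nat 1)) ?_
    simp [Function.comp_def, hstep, hx]
  have hAnS : ∀ x ∉ S, A x = ∑ y, A y * P y x := by
    intro x hx
    refine tendsto_nhds_unique ((hlim x).comp (tendsto_add_atTop_nat 1)) ?_
    simp only [Function.comp_def, hstep, hx, if_false]
    exact tendsto_finsetSum _ fun y _ => (hlim y).mul_const _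
  set d : α → ℝ := fun x => π x - A x with hd
  have hd0 : ∀ x, 0 ≤ d x := fun x => sub_nonneg.2 (hAle x)
  have hdS : ∀ x ∈ S, d x = 0 := fun x hx => by simp [hd, hAS x hx]
  have hge : ∀ x ∈ Finset.univ, d x ≤ ∑ y, d y * P y x := by
    intro x _
    by_cases hx : x ∈ S
    · rw [hdS x hx]
      exact Finset.sum_nonneg fun y _ => mul_nonneg (hd0 y) (hP0 y x)
    · simp only [hd, sub_mul, Finset.sum_sub_distrib, hinv]
      rw [← hAnS x hx]
  have htot : ∑ x, d x = ∑ x, ∑ y, d y * P y x := by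
    rw [Finset.sum_comm]
    refine Finset.sum_congr rfl fun y _ => ?_
    rw [← Finset.mul_sum, Matrix.sum_row_of_mem_rowStochastic hP, mul_one]
  -- `d ≤ d P` entrywise and both have the same total, so `d = d P`
  have heq := (Finset.sum_eq_sum_iff_of_le hge).1 htot
  obtain ⟨s, hs⟩ := hS
  have hdz := eq_zero_of_invariant_of_apply_eq_zero hirr hd0
    (fun x => (heq x (Finset.mem_univ x)).symm) (hdS s hs) x
  have hAx : π x = A x := by simpa [hd, sub_eq_zero] using hdz
  rw [hAx]
  exact (hsum x).hasSum

/-- If every state outside `S` moves into `S` with probability at least `ε`, the surviving mass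
decays geometrically. The first transition is not covered by the hypothesis, since the chain may
start in `S`. -/
lemma sum_tabooMass_succ_le (hP : P ∈ Matrix.rowStochastic ℝ α) (hinit : ∀ x, 0 ≤ init x)
    {ε : ℝ} (hε : ε ≤ 1) (hS : ∀ x ∉ S, ε ≤ ∑ y ∈ S, P x y) (t : ℕ) :
    ∑ x, tabooMass init P S (t + 1) x ≤ (1 - ε) ^ t * ∑ x, init x := by
  have hP0 : ∀ x y, 0 ≤ P x y := fun x y => Matrix.nonneg_of_mem_rowStochastic hP
  have hnn := tabooMass_nonneg (S := S) hinit hP0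
  have hrow : ∀ y, ∑ x, (if x ∈ S then 0 else P y x) = 1 - ∑ x ∈ S, P y x := by
    intro y
    have hS' := Finset.sum_ite_mem Finset.univ S fun x => P y x
    rw [Finset.univ_inter] at hS'
    rw [← Matrix.sum_row_of_mem_rowStochastic hP y, eq_sub_iff_add_eq, ← hS',
      ← Finset.sum_add_distrib]
    refine Finset.sum_congr rfl fun x _ => ?_
    split_ifs <;> simp
  have hmass : ∀ t, ∑ x, tabooMass init P S (t + 1) x =
      ∑ y, tabooMass init P S t y * (1 - ∑ x ∈ S, P y x) := by
    intro t
    simp_rw [← hrow, Finset.mul_sum]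
    rw [Finset.sum_comm]
    refine Finset.sum_congr rfl fun x _ => ?_
    rw [tabooMass]
    split_ifs <;> simp
  induction t with
  | zero =>
    rw [hmass, pow_zero, one_mul]
    refine Finset.sum_le_sum fun y _ => mul_le_of_le_one_right (hnn 0 y) ?_
    have : 0 ≤ ∑ x ∈ S, P y x := Finset.sum_nonneg fun x _ => hP0 y x
    linarith
  | succ t ih =>
    rw [hmass, pow_succ', mul_assoc]
    refine le_trans ?_ (mul_le_mul_of_nonneg_left ih (sub_nonneg.2 hε))
    rw [Finset.mul_sum]
    refine Finset.sum_le_sum fun y _ => ?_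
    by_cases hy : y ∈ S
    · simp [tabooMass_succ_of_mem hy]
    · rw [mul_comm]
      exact mul_le_mul_of_nonneg_right (by linarith [hS y hy]) (hnn _ y)

end Taboo

/-! ### Markov chains given by their finite-dimensional laws -/

lemma IsMarkovChain.measurableSet_prefix {α Ω : Type*} [MeasurableSpace α]
    [MeasurableSingletonClass α] [MeasurableSpace Ω] {μ : Measure Ω} {init : α → ℝ}
    {P : Matrix α α ℝ} {X : ℕ → Ω → α} (hX : IsMarkovChain μ init P X) (n : ℕ) (x : ℕ → α) :
    MeasurableSet {ω | ∀ t ≤ n, X t ω = x t} := by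
  simp only [Set.ofPred_forall]
  exact MeasurableSet.iInter fun t => MeasurableSet.iInter fun _ =>
    hX.measurable t (measurableSet_singleton _)

section Chain

variable {α : Type*} [Fintype α] [MeasurableSpace α] [MeasurableSingletonClass α]
  {Ω : Type*} [MeasurableSpace Ω] {μ : Measure Ω} [IsProbabilityMeasure μ]
  {init : α → ℝ} {P : Matrix α α ℝ} {X : ℕ → Ω → α}

/-- The Markov property: the next transition is independent of the past, given the present. -/
lemma IsMarkovChain.measureReal_step (hX : IsMarkovChain μ init P X) (t : ℕ)
    (A : (Fin (t + 1) → α) → Prop) (y x : α) :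
    μ.real {ω | (A (fun i => X i ω) ∧ X t ω = y) ∧ X (t + 1) ω = x} =
      μ.real {ω | A (fun i => X i ω) ∧ X t ω = y} * P y x := by
  classical
  -- a prefix of length `t + 1`, extended to an infinite path by the constant `x`
  let e : (Fin (t + 1) → α) → ℕ → α := fun p s => if h : s < t + 1 then p ⟨s, h⟩ else x
  have he : ∀ p (i : Fin (t + 1)), e p i = p i := fun p i => dif_pos i.2
  let F : Finset (Fin (t + 1) → α) := Finset.univ.filter fun p => A p ∧ p (Fin.last t) = y
  have hpre : ∀ p ω, (∀ s ≤ t, X s ω = e p s) ↔ (fun i : Fin (t + 1) => X i ω) = p := by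
    intro p ω
    constructor
    · intro h
      ext i
      rw [h i (Nat.lt_succ_iff.1 i.2), he]
    · rintro rfl s hs
      exact (he (fun i : Fin (t + 1) => X i ω) ⟨s, Nat.lt_succ_iff.2 hs⟩).symm
  have hpre' : ∀ p ω, (∀ s ≤ t + 1, X s ω = e p s) ↔
      (fun i : Fin (t + 1) => X i ω) = p ∧ X (t + 1) ω = x := by
    intro p ω
    rw [← hpre]
    constructor
    · intro h
      refine ⟨fun s hs => h s (by omega), ?_⟩
      rw [h (t + 1) le_rfl]
      simp [e]
    · rintro ⟨h, hx⟩ s hs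
      rcases hs.lt_or_eq with h' | rfl
      · exact h s (by omega)
      · simp [e, hx]
  have h1 : {ω | A (fun i => X i ω) ∧ X t ω = y} = ⋃ p ∈ F, {ω | ∀ s ≤ t, X s ω = e p s} := by
    ext ω
    simp [hpre, F]
  have h2 : {ω | (A (fun i => X i ω) ∧ X t ω = y) ∧ X (t + 1) ω = x} =
      ⋃ p ∈ F, {ω | ∀ s ≤ t + 1, X s ω = e p s} := by
    ext ω
    simp only [hpre', F, Set.mem_ofPred_eq, Set.mem_iUnion, Finset.mem_filter, Finset.mem_univ,
      true_and, exists_prop]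
    constructor
    · rintro ⟨h, hx⟩
      exact ⟨_, h, rfl, hx⟩
    · rintro ⟨p, h, rfl, hx⟩
      exact ⟨h, hx⟩
  rw [h1, h2, measureReal_biUnion_finset, measureReal_biUnion_finset, Finset.sum_mul]
  · refine Finset.sum_congr rfl fun p hp => ?_
    have hlast : e p t = y := by
      have := he p (Fin.last t)
      rw [Fin.val_last] at this
      rw [this]
      exact (Finset.mem_filter.1 hp).2.2
    have hnext : e p (t + 1) = x := by simp [e]
    rw [hX.law, hX.law, Finset.prod_range_succ, hlast, hnext, mul_assoc]
  · intro p _ q _ hpq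
    refine Set.disjoint_left.2 fun ω h h' => hpq ?_
    rw [← (hpre p ω).1 h, ← (hpre q ω).1 h']
  · exact fun p _ => hX.measurableSet_prefix t _
  · intro p _ q _ hpq
    refine Set.disjoint_left.2 fun ω h h' => hpq ?_
    rw [← ((hpre' p ω).1 h).1, ← ((hpre' q ω).1 h').1]
  · exact fun p _ => hX.measurableSet_prefix (t + 1) _

lemma IsMarkovChain.measureReal_taboo [DecidableEq α] (hX : IsMarkovChain μ init P X)
    (S : Finset α) (t : ℕ) (x : α) :
    μ.real {ω | (∀ j, 1 ≤ j → j ≤ t → X j ω ∉ S) ∧ X t ω = x} = tabooMass init P S t x := by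
  induction t generalizing x with
  | zero =>
    have h := hX.law 0 fun _ => x
    simp only [Finset.range_zero, Finset.prod_empty, mul_one] at h
    rw [tabooMass, ← h]
    congr 1
    ext ω
    simp only [Set.mem_ofPred_eq]
    constructor
    · rintro ⟨-, h⟩ s hs
      obtain rfl : s = 0 := by omega
      exact h
    · exact fun h => ⟨fun j h1 h0 => by omega, h 0 le_rfl⟩
  | succ t ih =>
    rw [tabooMass]
    split_ifs with hx
    · have : {ω | (∀ j, 1 ≤ j → j ≤ t + 1 → X j ω ∉ S) ∧ X (t + 1) ω = x} = ∅ := by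
        ext ω
        simp only [Set.mem_ofPred_eq, Set.mem_empty_iff_false, iff_false, not_and]
        rintro h rfl
        exact h (t + 1) (by omega) le_rfl hx
      simp [this]
    · have hset : {ω | (∀ j, 1 ≤ j → j ≤ t + 1 → X j ω ∉ S) ∧ X (t + 1) ω = x} =
          ⋃ y ∈ (Finset.univ : Finset α),
            {ω | ((∀ j : Fin (t + 1), 1 ≤ (j : ℕ) → X j ω ∉ S) ∧ X t ω = y) ∧
              X (t + 1) ω = x} := by
        ext ω
        simp only [Set.mem_ofPred_eq, Finset.mem_univ, Set.iUnion_true, Set.mem_iUnion]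
        constructor
        · rintro ⟨h, h'⟩
          exact ⟨_, ⟨fun j hj => h j hj (by omega), rfl⟩, h'⟩
        · rintro ⟨y, ⟨h, -⟩, rfl⟩
          refine ⟨fun j h1 h2 => ?_, rfl⟩
          rcases h2.lt_or_eq with h' | rfl
          · exact h ⟨j, h'⟩ h1
          · exact hx
      have hpast : ∀ y, {ω | (∀ j : Fin (t + 1), 1 ≤ (j : ℕ) → X j ω ∉ S) ∧ X t ω = y} =
          {ω | (∀ j, 1 ≤ j → j ≤ t → X j ω ∉ S) ∧ X t ω = y} := by
        intro y
        ext ω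
        refine and_congr_left fun _ => ?_
        exact ⟨fun h j h1 h2 => h ⟨j, by omega⟩ h1, fun h j h1 => h j h1 (by omega)⟩
      have hstep := fun y => hX.measureReal_step t
        (fun p => ∀ j : Fin (t + 1), 1 ≤ (j : ℕ) → p j ∉ S) y x
      rw [hset, measureReal_biUnion_finset]
      · refine Finset.sum_congr rfl fun y _ => ?_
        rw [hstep y, hpast, ih]
      · intro y _ z _ hyz
        exact Set.disjoint_left.2 fun ω h h' => hyz (h.1.2.symm.trans h'.1.2)
      · intro y _
        have hA : MeasurableSet {ω | ∀ j : Fin (t + 1), 1 ≤ (j : ℕ) → X j ω ∉ S} := by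
          simp only [Set.ofPred_forall]
          exact MeasurableSet.iInter fun j => MeasurableSet.iInter fun _ =>
            (hX.measurable j S.measurableSet).compl
        exact (hA.inter (hX.measurable t (measurableSet_singleton y))).inter
          (hX.measurable (t + 1) (measurableSet_singleton x))

/-- Two Markov chains with the same initial distribution and transition matrix have the same law
on the path space. -/
lemma IsMarkovChain.identDistrib {X' : ℕ → Ω → α} (hX : IsMarkovChain μ init P X)
    (hX' : IsMarkovChain μ init P X') :
    IdentDistrib (fun ω t => X t ω) (fun ω t => X' t ω) μ μ := by
  have hm : Measurable fun ω t => X t ω := measurable_pi_lambda _ hX.measurable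
  have hm' : Measurable fun ω t => X' t ω := measurable_pi_lambda _ hX'.measurable
  refine ⟨hm.aemeasurable, hm'.aemeasurable, ?_⟩
  have : IsProbabilityMeasure (μ.map fun ω t => X t ω) :=
    Measure.isProbabilityMeasure_map hm.aemeasurable
  have : IsProbabilityMeasure (μ.map fun ω t => X' t ω) :=
    Measure.isProbabilityMeasure_map hm'.aemeasurable
  have hlim : IsProjectiveLimit (μ.map fun ω t => X' t ω)
      (fun I : Finset ℕ => (μ.map fun ω t => X' t ω).map I.restrict) := fun I => rfl
  have hfam : IsProjectiveMeasureFamily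
      (fun I : Finset ℕ => (μ.map fun ω t => X' t ω).map I.restrict) := by
    intro I J hJI
    rw [Measure.map_map (Finset.measurable_restrict₂ hJI) (Finset.measurable_restrict I)]
    rfl
  have : ∀ I : Finset ℕ, IsFiniteMeasure ((μ.map fun ω t => X' t ω).map I.restrict) :=
    fun I => inferInstance
  refine IsProjectiveLimit.unique (P := fun I : Finset ℕ =>
    (μ.map fun ω t => X' t ω).map I.restrict) ?_ hlim
  rw [isProjectiveLimit_nat_iff hfam]
  intro n
  rw [Measure.map_map (Preorder.measurable_frestrictLe n) hm,
    Measure.map_map (Finset.measurable_restrict _) hm']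
  refine Measure.ext_of_singleton fun p => ?_
  have hp : MeasurableSet {p} := measurableSet_singleton p
  rw [Measure.map_apply ((Preorder.measurable_frestrictLe n).comp hm) hp,
    Measure.map_apply ((Finset.measurable_restrict _).comp hm') hp]
  obtain ⟨a⟩ : Nonempty α := ⟨p ⟨0, by simp⟩⟩
  let e : ℕ → α := fun s => if h : s ∈ Finset.Iic n then p ⟨s, h⟩ else a
  have key : ∀ x : ℕ → α, (fun i : Finset.Iic n => x i) = p ↔ ∀ t ≤ n, x t = e t := by
    intro x
    constructor
    · rintro rfl t ht
      simp [e, ht]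
    · intro h
      ext i
      have hi := Finset.mem_Iic.1 i.2
      rw [h i hi]
      simp [e, hi]
  have e1 : ((Preorder.frestrictLe n) ∘ fun ω t => X t ω) ⁻¹' {p} =
      {ω | ∀ t ≤ n, X t ω = e t} := by
    ext ω
    exact key fun t => X t ω
  have e2 : ((Finset.Iic n).restrict ∘ fun ω t => X' t ω) ⁻¹' {p} =
      {ω | ∀ t ≤ n, X' t ω = e t} := by
    ext ω
    exact key fun t => X' t ω
  rw [e1, e2, ← ENNReal.toReal_eq_toReal_iff' (measure_ne_top _ _) (measure_ne_top _ _)]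
  exact (hX.law n e).trans (hX'.law n e).symm

end Chain

/-! ### Averages over independent tours, truncated by length -/

/-- If the sums of the `‖y r‖` with `K < l r` are small on average once `K` is large, then the
averages of the `y r` with `l r ≤ K` have, jointly in `K` and the number of terms, the same limit
as the full averages. -/
lemma tendsto_truncated_average_of_tendsto {E : Type*} [NormedAddCommGroup E] [NormedSpace ℝ E]
    {y : ℕ → E} {l : ℕ → ℕ∞} {m : E} {τ : ℕ → ℝ}
    (hy : Tendsto (fun R : ℕ => (R : ℝ)⁻¹ • ∑ r ∈ Finset.range R, y r) atTop (𝓝 m))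
    (hτ : Tendsto τ atTop (𝓝 0))
    (htail : ∀ K : ℕ, Tendsto (fun R : ℕ => (R : ℝ)⁻¹ •
      ∑ r ∈ Finset.range R, if l r ≤ K then 0 else ‖y r‖) atTop (𝓝 (τ K))) :
    Tendsto (fun q : ℕ × ℕ => (q.2 : ℝ)⁻¹ •
      ∑ r ∈ Finset.range q.2, if l r ≤ q.1 then y r else 0) atTop (𝓝 m) := by
  rw [← prod_atTop_atTop_eq]
  have hfull : Tendsto (fun q : ℕ × ℕ => (q.2 : ℝ)⁻¹ • ∑ r ∈ Finset.range q.2, y r)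
      (atTop ×ˢ atTop) (𝓝 m) := hy.comp tendsto_snd
  suffices h : Tendsto (fun q : ℕ × ℕ => (q.2 : ℝ)⁻¹ •
      ∑ r ∈ Finset.range q.2, if l r ≤ q.1 then 0 else y r) (atTop ×ˢ atTop) (𝓝 0) by
    have := hfull.sub h
    rw [sub_zero] at this
    refine this.congr fun q => ?_
    rw [← smul_sub, ← Finset.sum_sub_distrib]
    congr 1
    refine Finset.sum_congr rfl fun r _ => ?_
    split_ifs <;> simp
  rw [Metric.tendsto_nhds]
  intro ε hε
  -- for `K ≥ K₀` the omitted terms are among those omitted at `K₀`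
  obtain ⟨K₀, hK₀⟩ := (hτ.eventually (gt_mem_nhds hε)).exists
  have h1 := (htail K₀).eventually (gt_mem_nhds hK₀)
  filter_upwards [(eventually_ge_atTop K₀).prod_mk h1] with q hq
  obtain ⟨hK, hR⟩ := hq
  rw [dist_zero_right]
  refine lt_of_le_of_lt ?_ hR
  rw [norm_smul, norm_inv, Real.norm_natCast, smul_eq_mul]
  refine mul_le_mul_of_nonneg_left ((norm_sum_le _ _).trans ?_) (by positivity)
  refine Finset.sum_le_sum fun r _ => ?_
  by_cases h : l r ≤ K₀
  · have h' : l r ≤ q.1 := h.trans (by exact_mod_cast hK)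
    simp [h, h']
  · rw [if_neg h]
    split_ifs <;> simp

section Average

variable {β : Type*} [MeasurableSpace β] {Ω : Type*} [MeasurableSpace Ω] {μ : Measure Ω}
  {Z : ℕ → Ω → β}
  {E : Type*} [NormedAddCommGroup E] [NormedSpace ℝ E] [CompleteSpace E]
  [MeasurableSpace E] [BorelSpace E]

/-- The strong law of large numbers for a function of independent, identically distributed random
elements. -/
lemma strong_law_ae_comp (hind : iIndepFun Z μ) (hid : ∀ r, IdentDistrib (Z r) (Z 0) μ μ)
    {F : β → E} (hF : Measurable F) (hint : Integrable (fun ω => F (Z 0 ω)) μ) :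
    ∀ᵐ ω ∂μ, Tendsto (fun R : ℕ => (R : ℝ)⁻¹ • ∑ r ∈ Finset.range R, F (Z r ω)) atTop
      (𝓝 (∫ ω, F (Z 0 ω) ∂μ)) :=
  strong_law_ae (fun r ω => F (Z r ω)) hint
    (fun _ _ hrs => (hind.indepFun hrs).comp hF hF) fun r => (hid r).comp hF

/-- The strong law of large numbers for averages that omit the terms whose almost surely finite
length exceeds `K`, jointly in `K` and the number of terms. -/
lemma tendsto_truncated_average (hind : iIndepFun Z μ)
    (hid : ∀ r, IdentDistrib (Z r) (Z 0) μ μ)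
    {F : β → E} (hF : Measurable F) (hint : Integrable (fun ω => F (Z 0 ω)) μ)
    {l : β → ℕ∞} (hl : Measurable l) (hfin : ∀ᵐ ω ∂μ, l (Z 0 ω) ≠ ⊤) :
    ∀ᵐ ω ∂μ, Tendsto (fun q : ℕ × ℕ => (q.2 : ℝ)⁻¹ •
      ∑ r ∈ Finset.range q.2, if l (Z r ω) ≤ q.1 then F (Z r ω) else 0) atTop
      (𝓝 (∫ ω, F (Z 0 ω) ∂μ)) := by
  have hset : ∀ K : ℕ, MeasurableSet {z | l z ≤ K} := fun K =>
    measurableSet_preimage hl (MeasurableSet.of_discrete (s := Set.Iic (K : ℕ∞)))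
  have hT : ∀ K : ℕ, Measurable fun z => if l z ≤ K then 0 else ‖F z‖ := fun K =>
    Measurable.ite (hset K) measurable_const hF.norm
  have hTint : ∀ K : ℕ, Integrable (fun ω => if l (Z 0 ω) ≤ K then 0 else ‖F (Z 0 ω)‖) μ := by
    intro K
    refine hint.norm.mono
      (Measurable.comp_aemeasurable (g := fun z => if l z ≤ K then 0 else ‖F z‖) (hT K)
        (hid 0).aemeasurable_fst).aestronglyMeasurable ?_
    filter_upwards with ω
    split_ifs <;> simp
  have htail : Tendsto (fun K : ℕ => ∫ ω, (if l (Z 0 ω) ≤ K then 0 else ‖F (Z 0 ω)‖) ∂μ)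
      atTop (𝓝 0) := by
    have := tendsto_integral_of_dominated_convergence (μ := μ) (f := fun _ => (0 : ℝ))
      (F := fun (K : ℕ) ω => if l (Z 0 ω) ≤ K then 0 else ‖F (Z 0 ω)‖)
      (fun ω => ‖F (Z 0 ω)‖) (fun K => (hTint K).1) hint.norm
      (fun K => by filter_upwards with ω; split_ifs <;> simp) ?_
    · simpa using this
    filter_upwards [hfin] with ω hω
    obtain ⟨n, hn⟩ := ENat.ne_top_iff_exists.1 hω
    refine tendsto_const_nhds.congr' ?_
    filter_upwards [eventually_ge_atTop n] with K hK
    rw [if_pos]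
    rw [← hn]
    exact_mod_cast hK
  have hall : ∀ᵐ ω ∂μ, ∀ K : ℕ, Tendsto (fun R : ℕ => (R : ℝ)⁻¹ •
      ∑ r ∈ Finset.range R, if l (Z r ω) ≤ K then 0 else ‖F (Z r ω)‖) atTop
      (𝓝 (∫ ω, (if l (Z 0 ω) ≤ K then 0 else ‖F (Z 0 ω)‖) ∂μ)) :=
    ae_all_iff.2 fun K =>
      strong_law_ae_comp (F := fun z => if l z ≤ K then 0 else ‖F z‖) hind hid (hT K) (hTint K)
  filter_upwards [strong_law_ae_comp hind hid hF hint, hall] with ω h1 h2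
  exact tendsto_truncated_average_of_tendsto h1 htail h2

end Average

/-! ### Tours -/

section Tour

variable {nV nH : ℕ} {S : Finset (State nV nH)}

lemma coe_lt_tourLength {x : ℕ → State nV nH} {t : ℕ} :
    (t : ℕ∞) < tourLength S x ↔ ∀ j, 1 ≤ j → j ≤ t → x j ∉ S := by
  rw [← ENat.add_one_le_iff (ENat.natCast_ne_top t), tourLength, le_iInf₂_iff]
  constructor
  · intro h j h1 h2 h3
    have := h j ⟨h1, h3⟩
    norm_cast at this
    omega
  · rintro h j ⟨h1, h3⟩
    have : ¬ j ≤ t := fun h2 => h j h1 h2 h3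
    norm_cast
    omega

lemma one_le_tourLength (x : ℕ → State nV nH) : 1 ≤ tourLength S x := by
  have : ((0 : ℕ) : ℕ∞) < tourLength S x := coe_lt_tourLength.2 fun j h1 h2 => by omega
  exact Order.one_le_iff_pos.2 (by exact_mod_cast this)

lemma measurable_tourLength : Measurable (tourLength S) := by
  have hgt : ∀ t : ℕ, MeasurableSet {x | (t : ℕ∞) < tourLength S x} := by
    intro t
    simp only [coe_lt_tourLength, Set.ofPred_forall]
    exact MeasurableSet.iInter fun j => MeasurableSet.iInter fun _ => MeasurableSet.iInter fun _ =>
      (measurableSet_preimage (f := fun x : ℕ → State nV nH => x j) (measurable_pi_apply j)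
        S.measurableSet).compl
  refine measurable_to_countable' fun k => ?_
  induction k using ENat.recTopCoe with
  | top =>
    have : tourLength S ⁻¹' {⊤} = ⋂ t : ℕ, {x | (t : ℕ∞) < tourLength S x} := by
      ext x
      simp only [Set.mem_preimage, Set.mem_singleton_iff, Set.mem_iInter, Set.mem_ofPred_eq]
      exact ENat.eq_top_iff_forall_gt
    rw [this]
    exact MeasurableSet.iInter hgt
  | coe k =>
    rcases k with _ | k
    · have : tourLength S ⁻¹' {((0 : ℕ) : ℕ∞)} = ∅ := by
        ext x
        have := one_le_tourLength (S := S) x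
        simp only [Set.mem_preimage, Set.mem_singleton_iff, Set.mem_empty_iff_false, iff_false]
        intro h
        rw [h] at this
        norm_num at this
      rw [this]
      exact MeasurableSet.empty
    · have : tourLength S ⁻¹' {((k + 1 : ℕ) : ℕ∞)} =
          {x | (k : ℕ∞) < tourLength S x} \ {x | ((k + 1 : ℕ) : ℕ∞) < tourLength S x} := by
        ext x
        simp only [Set.mem_preimage, Set.mem_singleton_iff, Set.mem_sdiff, Set.mem_ofPred_eq,
          not_lt]
        rw [← ENat.add_one_le_iff (ENat.natCast_ne_top k)]
        push_cast
        exact ⟨fun h => ⟨h.ge, h.le⟩, fun h => le_antisymm h.2 h.1⟩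
      rw [this]
      exact (hgt k).diff (hgt (k + 1))

variable {E : Type*} [NormedAddCommGroup E]

/-- The sum of `f` over all states of the tour along the trajectory `x`. It is `0` if the tour
does not end. -/
noncomputable def visitSum (S : Finset (State nV nH)) (f : State nV nH → E)
    (x : ℕ → State nV nH) : E :=
  ∑ i ∈ Finset.range (tourLength S x).toNat, f (x i)

lemma measurable_visitSum [MeasurableSpace E] [BorelSpace E] [SecondCountableTopology E]
    (f : State nV nH → E) : Measurable (visitSum S f) := by
  have h : Measurable fun p : ℕ × (ℕ → State nV nH) => ∑ i ∈ Finset.range p.1, f (p.2 i) :=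
    measurable_from_prod_countable_right fun n =>
      Finset.measurable_fun_sum (Finset.range n) fun i _ =>
      (measurable_of_finite f).comp (measurable_pi_apply i)
  exact h.comp (((measurable_of_countable ENat.toNat).comp measurable_tourLength).prodMk
    measurable_id)

/-- For a tour that ends, the sum over its states is a series over all times, in which the states
after the return to `S` are suppressed. -/
lemma visitSum_eq_tsum (f : State nV nH → E) {x : ℕ → State nV nH} (hx : tourLength S x ≠ ⊤) :
    visitSum S f x = ∑' t : ℕ, if (t : ℕ∞) < tourLength S x then f (x t) else 0 := by
  obtain ⟨n, hn⟩ := ENat.ne_top_iff_exists.1 hx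
  rw [tsum_eq_sum (s := Finset.range n), visitSum, ← hn, ENat.toNat_natCast]
  · refine Finset.sum_congr rfl fun i hi => ?_
    rw [if_pos (by exact_mod_cast Finset.mem_range.1 hi)]
  · intro t ht
    rw [← hn, if_neg]
    exact_mod_cast fun h => ht (Finset.mem_range.2 h)

end Tour

/-! ### Expected sums over a tour -/

section Expectation

variable {nV nH : ℕ} {W : Params nV nH} {S : Finset (State nV nH)}
  {P : Matrix (State nV nH) (State nV nH) ℝ}

lemma partition_pos (W : Params nV nH) : 0 < partition W :=
  Finset.sum_pos (fun _ _ => Real.exp_pos _) Finset.univ_nonempty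

lemma stoppingPartition_pos (W : Params nV nH) (hS : S.Nonempty) : 0 < stoppingPartition W S :=
  Finset.sum_pos (fun _ _ => Real.exp_pos _) hS

lemma startProb_nonneg (x : State nV nH) : 0 ≤ startProb W S x := by
  rw [startProb]
  split_ifs
  · exact div_nonneg (Real.exp_pos _).le (Finset.sum_nonneg fun _ _ => (Real.exp_pos _).le)
  · exact le_rfl

lemma sum_startProb (hS : S.Nonempty) : ∑ x, startProb W S x = 1 := by
  simp only [startProb, Finset.sum_ite_mem, Finset.univ_inter]
  rw [← Finset.sum_div]
  exact div_self (stoppingPartition_pos W hS).ne'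

/-- The number of visits to `x` in a tour has expectation `exp(-E(x)) / Z_S`. -/
lemma hasSum_tabooMass_startProb (hP : IsReversibleChain W P) (hS : S.Nonempty)
    (x : State nV nH) :
    HasSum (fun t => tabooMass (startProb W S) P S t x)
      (Real.exp (-stateEnergy x W) / stoppingPartition W S) := by
  refine hasSum_tabooMass (π := fun x => Real.exp (-stateEnergy x W) / stoppingPartition W S)
    hP.stochastic hP.irreducible (fun x => div_nonneg (Real.exp_pos _).le
      (stoppingPartition_pos W hS).le) (fun x => ?_) hS x
  have hZ := (partition_pos W).ne'
  have hdb : ∀ y, Real.exp (-stateEnergy y W) * P y x = Real.exp (-stateEnergy x W) * P x y := by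
    intro y
    have := hP.detailedBalance y x
    simp only [prob] at this
    field_simp at this
    linarith
  calc ∑ y, Real.exp (-stateEnergy y W) / stoppingPartition W S * P y x
      = ∑ y, Real.exp (-stateEnergy x W) / stoppingPartition W S * P x y := by
        refine Finset.sum_congr rfl fun y _ => ?_
        rw [div_mul_eq_mul_div, hdb, div_mul_eq_mul_div]
    _ = _ := by
        rw [← Finset.mul_sum, Matrix.sum_row_of_mem_rowStochastic hP.stochastic, mul_one]

variable {E : Type*} [NormedAddCommGroup E]

lemma ite_lt_tourLength_eq_sum {Ω : Type*} {X : ℕ → Ω → State nV nH} (f : State nV nH → E)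
    (t : ℕ) (ω : Ω) :
    (if (t : ℕ∞) < tourLength S (fun s => X s ω) then f (X t ω) else 0) =
      ∑ x, Set.indicator {ω | (t : ℕ∞) < tourLength S (fun s => X s ω) ∧ X t ω = x}
        (fun _ => f x) ω := by
  split_ifs with h
  · rw [Finset.sum_eq_single (X t ω)]
    · simp [h]
    · intro x _ hx
      simp [hx.symm]
    · simp
  · simp [h]

variable {Ω : Type*} [MeasurableSpace Ω] {μ : Measure Ω} {X : ℕ → Ω → State nV nH}

lemma IsMarkovChain.measurable_path (hX : IsMarkovChain μ (startProb W S) P X) :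
    Measurable fun ω t => X t ω :=
  measurable_pi_lambda _ hX.measurable

lemma IsMarkovChain.measurableSet_lt_tourLength (hX : IsMarkovChain μ (startProb W S) P X)
    (t : ℕ) : MeasurableSet {ω | (t : ℕ∞) < tourLength S (fun s => X s ω)} :=
  measurableSet_preimage (measurable_tourLength.comp hX.measurable_path)
    (MeasurableSet.of_discrete (s := Set.Ioi (t : ℕ∞)))

lemma IsMarkovChain.measurableSet_lengthEvent (hX : IsMarkovChain μ (startProb W S) P X)
    (k : ℕ) : MeasurableSet (lengthEvent S X k) :=
  measurableSet_preimage (measurable_tourLength.comp hX.measurable_path)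
    (MeasurableSet.of_discrete (s := {(k : ℕ∞)}))

lemma IsMarkovChain.measurableSet_lt_tourLength_inter
    (hX : IsMarkovChain μ (startProb W S) P X) (t : ℕ) (x : State nV nH) :
    MeasurableSet {ω | (t : ℕ∞) < tourLength S (fun s => X s ω) ∧ X t ω = x} :=
  (hX.measurableSet_lt_tourLength t).inter (hX.measurable t (measurableSet_singleton x))

variable [IsProbabilityMeasure μ]

lemma IsMarkovChain.measureReal_lt_tourLength_inter (hX : IsMarkovChain μ (startProb W S) P X)
    (t : ℕ) (x : State nV nH) :
    μ.real {ω | (t : ℕ∞) < tourLength S (fun s => X s ω) ∧ X t ω = x} =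
      tabooMass (startProb W S) P S t x := by
  rw [← hX.measureReal_taboo S t x]
  simp only [coe_lt_tourLength]

lemma IsMarkovChain.integrable_ite_lt_tourLength (hX : IsMarkovChain μ (startProb W S) P X)
    (f : State nV nH → E) (t : ℕ) :
    Integrable (fun ω => if (t : ℕ∞) < tourLength S (fun s => X s ω) then f (X t ω) else 0)
      μ := by
  simp only [ite_lt_tourLength_eq_sum]
  exact integrable_finsetSum _ fun x _ =>
    (integrable_const _).indicator (hX.measurableSet_lt_tourLength_inter t x)

lemma IsMarkovChain.integral_ite_lt_tourLength [NormedSpace ℝ E] [CompleteSpace E]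
    (hX : IsMarkovChain μ (startProb W S) P X) (f : State nV nH → E) (t : ℕ) :
    ∫ ω, (if (t : ℕ∞) < tourLength S (fun s => X s ω) then f (X t ω) else 0) ∂μ =
      ∑ x, tabooMass (startProb W S) P S t x • f x := by
  simp only [ite_lt_tourLength_eq_sum]
  rw [integral_finsetSum _ fun x _ =>
    (integrable_const _).indicator (hX.measurableSet_lt_tourLength_inter t x)]
  refine Finset.sum_congr rfl fun x _ => ?_
  rw [integral_indicator_const _ (hX.measurableSet_lt_tourLength_inter t x),
    hX.measureReal_lt_tourLength_inter]

lemma IsMarkovChain.measureReal_lt_tourLength (hX : IsMarkovChain μ (startProb W S) P X)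
    (t : ℕ) :
    μ.real {ω | (t : ℕ∞) < tourLength S (fun s => X s ω)} =
      ∑ x, tabooMass (startProb W S) P S t x := by
  have h := hX.integral_ite_lt_tourLength (fun _ => (1 : ℝ)) t
  simp only [smul_eq_mul, mul_one] at h
  rw [← h, ← integral_indicator_one (hX.measurableSet_lt_tourLength t)]
  simp only [Set.indicator, Set.mem_ofPred_eq, Pi.one_apply]

lemma IsMarkovChain.ae_tourLength_ne_top (hX : IsMarkovChain μ (startProb W S) P X)
    (hP : IsReversibleChain W P) (hS : S.Nonempty) :
    ∀ᵐ ω ∂μ, tourLength S (fun s => X s ω) ≠ ⊤ := by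
  have hlim : Tendsto (fun t : ℕ => μ.real {ω | (t : ℕ∞) < tourLength S (fun s => X s ω)})
      atTop (𝓝 0) := by
    simp only [hX.measureReal_lt_tourLength]
    exact (hasSum_sum fun x _ =>
      hasSum_tabooMass_startProb hP hS x).summable.tendsto_atTop_zero
  have hzero : μ.real {ω | tourLength S (fun s => X s ω) = ⊤} = 0 := by
    refine le_antisymm (ge_of_tendsto' hlim fun t => measureReal_mono fun ω hω => ?_)
      measureReal_nonneg
    rw [Set.mem_ofPred_eq] at hω ⊢
    rw [hω]
    exact ENat.natCast_lt_top t
  rw [ae_iff]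
  simpa [measureReal_eq_zero_iff] using hzero

lemma IsMarkovChain.summable_integral_norm (hX : IsMarkovChain μ (startProb W S) P X)
    (hP : IsReversibleChain W P) (hS : S.Nonempty) (f : State nV nH → E) :
    Summable fun t : ℕ =>
      ∫ ω, ‖if (t : ℕ∞) < tourLength S (fun s => X s ω) then f (X t ω) else 0‖ ∂μ := by
  have h : ∀ (t : ℕ) ω, ‖if (t : ℕ∞) < tourLength S (fun s => X s ω) then f (X t ω) else 0‖ =
      if (t : ℕ∞) < tourLength S (fun s => X s ω) then ‖f (X t ω)‖ else 0 := by
    intro t ω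
    split_ifs <;> simp
  simp only [h, hX.integral_ite_lt_tourLength fun x => ‖f x‖]
  exact (hasSum_sum fun x _ =>
    (hasSum_tabooMass_startProb hP hS x).smul_const ‖f x‖).summable

lemma IsMarkovChain.integrable_visitSum [MeasurableSpace E] [BorelSpace E]
    [SecondCountableTopology E] (hX : IsMarkovChain μ (startProb W S) P X)
    (hP : IsReversibleChain W P) (hS : S.Nonempty) (f : State nV nH → E) :
    Integrable (fun ω => visitSum S f (fun t => X t ω)) μ := by
  refine ⟨((measurable_visitSum f).comp hX.measurable_path).aestronglyMeasurable, ?_⟩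
  let F : ℕ → Ω → E := fun t ω =>
    if (t : ℕ∞) < tourLength S (fun s => X s ω) then f (X t ω) else 0
  have hF : ∀ t, Integrable (F t) μ := hX.integrable_ite_lt_tourLength f
  calc ∫⁻ ω, ‖visitSum S f (fun t => X t ω)‖ₑ ∂μ
      = ∫⁻ ω, ‖∑' t, F t ω‖ₑ ∂μ := by
        refine lintegral_congr_ae ?_
        filter_upwards [hX.ae_tourLength_ne_top hP hS] with ω hω
        rw [visitSum_eq_tsum f hω]
    _ ≤ ∫⁻ ω, ∑' t, ‖F t ω‖ₑ ∂μ := lintegral_mono fun ω => enorm_tsum_le_tsum_enorm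
    _ = ∑' t, ∫⁻ ω, ‖F t ω‖ₑ ∂μ := lintegral_tsum fun t => (hF t).1.enorm
    _ = ∑' t, ENNReal.ofReal (∫ ω, ‖F t ω‖ ∂μ) := by
        simp only [ofReal_integral_norm_eq_lintegral_enorm (hF _)]
    _ < ⊤ := by
        rw [← ENNReal.ofReal_tsum_of_nonneg (fun t => integral_nonneg fun ω => norm_nonneg _)
          (hX.summable_integral_norm hP hS f)]
        exact ENNReal.ofReal_lt_top

/-- The expected sum of `f` over a tour is the sum of `f` against `exp(-E) / Z_S`. -/
lemma IsMarkovChain.integral_visitSum [NormedSpace ℝ E] [CompleteSpace E]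
    (hX : IsMarkovChain μ (startProb W S) P X)
    (hP : IsReversibleChain W P) (hS : S.Nonempty) (f : State nV nH → E) :
    ∫ ω, visitSum S f (fun t => X t ω) ∂μ =
      ∑ x, (Real.exp (-stateEnergy x W) / stoppingPartition W S) • f x := by
  have h1 := hasSum_integral_of_summable_integral_norm (hX.integrable_ite_lt_tourLength f)
    (hX.summable_integral_norm hP hS f)
  simp only [hX.integral_ite_lt_tourLength f] at h1
  rw [integral_congr_ae (g := fun ω => ∑' t : ℕ,
    if (t : ℕ∞) < tourLength S (fun s => X s ω) then f (X t ω) else 0)]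
  · exact h1.unique (hasSum_sum fun x _ =>
      (hasSum_tabooMass_startProb hP hS x).smul_const (f x))
  · filter_upwards [hX.ae_tourLength_ne_top hP hS] with ω hω
    exact visitSum_eq_tsum f hω

/-- The expected tour length is `Z / Z_S`. -/
lemma IsMarkovChain.integral_visitSum_one (hX : IsMarkovChain μ (startProb W S) P X)
    (hP : IsReversibleChain W P) (hS : S.Nonempty) :
    ∫ ω, visitSum S (fun _ => (1 : ℝ)) (fun t => X t ω) ∂μ =
      partition W / stoppingPartition W S := by
  rw [hX.integral_visitSum hP hS, partition, Finset.sum_div]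
  simp

/-- The probability of a tour of length `k` decays exponentially if the chain moves into `S` from
each outside state with probability at least `ε`. -/
lemma IsMarkovChain.measureReal_lengthEvent_succ_succ_le
    (hX : IsMarkovChain μ (startProb W S) P X) (hP : IsReversibleChain W P) (hS : S.Nonempty)
    {ε : ℝ} (hε : ε ≤ 1) (h : ∀ x ∉ S, ε ≤ ∑ y ∈ S, P x y) (k : ℕ) :
    μ.real (lengthEvent S X (k + 2)) ≤ (1 - ε) ^ k := by
  have h1 := sum_tabooMass_succ_le hP.stochastic (init := startProb W S) startProb_nonneg hε h k
  rw [sum_startProb hS, mul_one, ← hX.measureReal_lt_tourLength] at h1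
  refine le_trans (measureReal_mono fun ω hω => ?_) h1
  have hω' : tourLength S (fun t => X t ω) = ((k + 2 : ℕ) : ℕ∞) := hω
  rw [Set.mem_ofPred_eq, hω']
  exact_mod_cast Nat.lt_succ_self (k + 1)

end Expectation

/-- `k ρᵏ` decays exponentially for `0 < ρ < 1`: with `ρ = exp(-2c)`, half of the exponent absorbs
the factor `k`. -/
lemma exists_mul_pow_le_exp {ρ : ℝ} (h0 : 0 < ρ) (h1 : ρ < 1) :
    ∃ C c : ℝ, 0 < C ∧ 0 < c ∧ ∀ k : ℕ, k * ρ ^ k ≤ C * Real.exp (-c * k) := by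
  have hc : 0 < -Real.log ρ / 2 := by linarith [Real.log_neg h0 h1]
  refine ⟨(-Real.log ρ / 2)⁻¹, -Real.log ρ / 2, inv_pos.2 hc, hc, fun k => ?_⟩
  set c := -Real.log ρ / 2 with hcdef
  have hρ : ρ ^ k = (Real.exp (c * k))⁻¹ * Real.exp (-c * k) := by
    rw [← Real.exp_neg, ← Real.exp_add, ← Real.exp_log (pow_pos h0 k), Real.log_pow]
    congr 1
    rw [hcdef]
    ring
  have hk : (k : ℝ) ≤ c⁻¹ * Real.exp (c * k) := by
    rw [le_inv_mul_iff₀ hc]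
    linarith [Real.add_one_le_exp (c * k)]
  calc (k : ℝ) * ρ ^ k
      ≤ c⁻¹ * Real.exp (c * k) * ρ ^ k := mul_le_mul_of_nonneg_right hk (pow_nonneg h0.le k)
    _ = c⁻¹ * Real.exp (-c * k) := by
        rw [hρ]
        field_simp

/-! ### The gradient of the log-likelihood -/

section Gradient

variable {nV nH : ℕ}

/-- The vector that represents the linear form `energy v h` in the parameters. -/
noncomputable def energyCoeff (v : Fin nV → ℝ) (h : Fin nH → ℝ) : Params nV nH :=
  WithLp.toLp 2 (Sum.elim (fun p => -(v p.1 * h p.2)) (Sum.elim (fun i => -v i) fun j => -h j))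

lemma energy_eq_inner (v : Fin nV → ℝ) (h : Fin nH → ℝ) (W : Params nV nH) :
    energy v h W = inner ℝ (energyCoeff v h) W := by
  simp only [energy, energyCoeff, weights, visibleBias, hiddenBias, dotProduct, Matrix.mulVec,
    Matrix.of_apply, PiLp.inner_apply, Fintype.sum_sum_type, Fintype.sum_prod_type, Sum.elim_inl,
    Sum.elim_inr, Finset.mul_sum, RCLike.inner_apply, conj_trivial, mul_neg,
    Finset.sum_neg_distrib]
  rw [sub_sub, sub_eq_add_neg, neg_add]
  congr 1
  congr 1
  refine Finset.sum_congr rfl fun i _ => Finset.sum_congr rfl fun j _ => ?_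
  ring

lemma hasGradientAt_inner {F : Type*} [NormedAddCommGroup F] [InnerProductSpace ℝ F]
    [CompleteSpace F] (c w : F) : HasGradientAt (fun w => inner ℝ c w) c w := by
  rw [hasGradientAt_iff_hasFDerivAt]
  exact (InnerProductSpace.toDual ℝ F c).hasFDerivAt

lemma gradient_energy (v : Fin nV → ℝ) (h : Fin nH → ℝ) (W : Params nV nH) :
    gradient (energy v h) W = energyCoeff v h := by
  rw [funext (energy_eq_inner v h)]
  exact (hasGradientAt_inner _ _).gradient

lemma energyGrad_eq (W : Params nV nH) (x : State nV nH) :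
    energyGrad W x = energyCoeff (toReal x.1) (toReal x.2) :=
  gradient_energy _ _ W

/-- `energyCoeff` is affine in the hidden vector, so it commutes with averages over `h`. -/
lemma energyCoeff_sum_smul {ι : Type*} (s : Finset ι) (v : Fin nV → ℝ) (q : ι → ℝ)
    (h : ι → Fin nH → ℝ) (hq : ∑ i ∈ s, q i = 1) :
    energyCoeff v (∑ i ∈ s, q i • h i) = ∑ i ∈ s, q i • energyCoeff v (h i) := by
  ext a
  rw [WithLp.ofLp_sum, Finset.sum_apply]
  rcases a with ⟨i, j⟩ | i | j
  · simp only [energyCoeff, Sum.elim_inl, WithLp.ofLp_smul, Pi.smul_apply, smul_eq_mul,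
      Finset.sum_apply, Finset.mul_sum, mul_neg, Finset.sum_neg_distrib]
    congr 1
    exact Finset.sum_congr rfl fun k _ => by ring
  · simp only [energyCoeff, Sum.elim_inl, Sum.elim_inr, WithLp.ofLp_smul, Pi.smul_apply,
      smul_eq_mul, ← Finset.sum_mul, hq, one_mul]
  · simp [energyCoeff]

/-- The gradient of a log-sum-exp of linear forms is the average of the forms under the softmax
weights. -/
lemma hasGradientAt_log_sum_exp {F ι : Type*} [NormedAddCommGroup F] [InnerProductSpace ℝ F]
    [CompleteSpace F] (s : Finset ι) (hs : s.Nonempty) (c : ι → F) (w : F) :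
    HasGradientAt (fun w => Real.log (∑ i ∈ s, Real.exp (-inner ℝ (c i) w)))
      (-∑ i ∈ s, (Real.exp (-inner ℝ (c i) w) / ∑ j ∈ s, Real.exp (-inner ℝ (c j) w)) • c i)
      w := by
  have hpos : 0 < ∑ j ∈ s, Real.exp (-inner ℝ (c j) w) :=
    Finset.sum_pos (fun _ _ => Real.exp_pos _) hs
  have hc : ∀ i ∈ s, HasFDerivAt (fun w => Real.exp (-inner ℝ (c i) w))
      (Real.exp (-inner ℝ (c i) w) • -(InnerProductSpace.toDual ℝ F (c i))) w := fun i _ =>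
    (InnerProductSpace.toDual ℝ F (c i)).hasFDerivAt.neg.exp
  rw [hasGradientAt_iff_hasFDerivAt]
  refine ((HasFDerivAt.fun_sum hc).log hpos.ne').congr_fderiv ?_
  simp only [map_neg, map_sum, map_smulₛₗ, conj_trivial, smul_neg, Finset.sum_neg_distrib,
    Finset.smul_sum, smul_smul, div_eq_inv_mul]

lemma log_sum_prob (v : Fin nV → Fin 2) (W : Params nV nH) :
    Real.log (∑ h : Fin nH → Fin 2, prob W (v, h)) =
      Real.log (∑ h : Fin nH → Fin 2, Real.exp (-stateEnergy (v, h) W)) -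
        Real.log (partition W) := by
  simp only [prob]
  rw [← Finset.sum_div, Real.log_div _ (partition_pos W).ne']
  exact (Finset.sum_pos (fun _ _ => Real.exp_pos _) Finset.univ_nonempty).ne'

lemma condHidden_eq (W : Params nV nH) (v : Fin nV → Fin 2) (h : Fin nH → Fin 2) :
    condHidden W v h = Real.exp (-stateEnergy (v, h) W) /
      ∑ h' : Fin nH → Fin 2, Real.exp (-stateEnergy (v, h') W) := by
  simp only [condHidden, prob]
  rw [← Finset.sum_div, div_div_div_cancel_right₀ (partition_pos W).ne']

lemma sum_condHidden (W : Params nV nH) (v : Fin nV → Fin 2) : ∑ h, condHidden W v h = 1 := by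
  simp only [condHidden_eq]
  rw [← Finset.sum_div]
  exact div_self (Finset.sum_pos (fun _ _ => Real.exp_pos _) Finset.univ_nonempty).ne'

lemma dataEnergyGrad_eq (W : Params nV nH) (v : Fin nV → Fin 2) :
    dataEnergyGrad W v = ∑ h, condHidden W v h • energyGrad W (v, h) := by
  rw [dataEnergyGrad, gradient_energy, meanHidden,
    energyCoeff_sum_smul _ _ _ _ (sum_condHidden W v)]
  simp only [energyGrad_eq]

/-- The gradient of the negative log-likelihood is the difference between the average energy
gradients under the data and under the model. -/
lemma hasGradientAt_negLogLik {N : ℕ} (hN : 0 < N) (data : Fin N → Fin nV → Fin 2)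
    (W : Params nV nH) :
    HasGradientAt (negLogLik data)
      ((1 / (N : ℝ)) • ∑ n, dataEnergyGrad W (data n) - ∑ x, prob W x • energyGrad W x) W := by
  have hdata : ∀ v : Fin nV → Fin 2, HasGradientAt (fun W : Params nV nH =>
      Real.log (∑ h : Fin nH → Fin 2, Real.exp (-stateEnergy (v, h) W)))
      (-dataEnergyGrad W v) W := by
    intro v
    have := hasGradientAt_log_sum_exp Finset.univ Finset.univ_nonempty
      (fun h : Fin nH → Fin 2 => energyCoeff (toReal v) (toReal h)) W
    simp only [dataEnergyGrad_eq, condHidden_eq, stateEnergy, energy_eq_inner, energyGrad_eq]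
    exact this
  have hmodel : HasGradientAt (fun W : Params nV nH => Real.log (partition W))
      (-∑ x, prob W x • energyGrad W x) W := by
    have := hasGradientAt_log_sum_exp Finset.univ Finset.univ_nonempty
      (fun x : State nV nH => energyCoeff (toReal x.1) (toReal x.2)) W
    simp only [prob, partition, stateEnergy, energy_eq_inner, energyGrad_eq]
    exact this
  have hN' : (N : ℝ) ≠ 0 := by exact_mod_cast hN.ne'
  simp only [hasGradientAt_iff_hasFDerivAt] at hdata hmodel ⊢
  have h1 := ((HasFDerivAt.fun_sum fun n (_ : n ∈ Finset.univ) =>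
    (hdata (data n)).sub hmodel).const_mul (1 / (N : ℝ))).neg
  have hf : negLogLik data = fun W : Params nV nH => -(1 / (N : ℝ) * ∑ n, (Real.log
      (∑ h : Fin nH → Fin 2, Real.exp (-stateEnergy (data n, h) W)) -
        Real.log (partition W))) := by
    funext W
    simp only [negLogLik, log_sum_prob]
  rw [hf]
  refine h1.congr_fderiv ?_
  simp only [map_sub, map_smulₛₗ, conj_trivial, map_neg, map_sum, Finset.sum_sub_distrib,
    Finset.sum_neg_distrib, Finset.sum_const, Finset.card_univ, Fintype.card_fin, smul_sub,
    smul_neg]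
  rw [← Nat.cast_smul_eq_nsmul ℝ, smul_smul, one_div_mul_cancel hN', one_smul]
  abel

end Gradient

/-! ### The estimator as a ratio of sums over tours -/

section Estimator

variable {nV nH : ℕ} {S : Finset (State nV nH)}

lemma sum_toursOfLength {M : Type*} [AddCommMonoid M] (x : ℕ → ℕ → State nV nH) (R k : ℕ)
    (F : ℕ → M) :
    ∑ r ∈ toursOfLength S x R k, F r =
      ∑ r ∈ Finset.range R, if tourLength S (x r) = k then F r else 0 := by
  rw [toursOfLength, Finset.sum_filter]

lemma sum_Icc_ite_tourLength {M : Type*} [AddCommMonoid M] (x : ℕ → State nV nH) (K : ℕ)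
    (F : ℕ → M) :
    ∑ k ∈ Finset.Icc 1 K, (if tourLength S x = k then F k else 0) =
      if tourLength S x ≤ K then F (tourLength S x).toNat else 0 := by
  split_ifs with h
  · obtain ⟨n, hn⟩ := ENat.ne_top_iff_exists.1 (ne_top_of_le_ne_top (ENat.natCast_ne_top K) h)
    have h1 := one_le_tourLength (S := S) x
    rw [← hn] at h h1 ⊢
    norm_cast at h h1
    simp [Nat.cast_inj, h, h1]
  · refine Finset.sum_eq_zero fun k hk => if_neg fun hxk => h ?_
    rw [hxk]
    exact_mod_cast (Finset.mem_Icc.1 hk).2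

lemma sum_Icc_sum_toursOfLength {M : Type*} [AddCommMonoid M] (x : ℕ → ℕ → State nV nH)
    (K R : ℕ) (F : ℕ → ℕ → M) :
    ∑ k ∈ Finset.Icc 1 K, ∑ r ∈ toursOfLength S x R k, F k r =
      ∑ r ∈ Finset.range R,
        if tourLength S (x r) ≤ K then F (tourLength S (x r)).toNat r else 0 := by
  simp only [sum_toursOfLength]
  rw [Finset.sum_comm]
  exact Finset.sum_congr rfl fun r _ => sum_Icc_ite_tourLength (x r) K fun k => F k r

lemma numCompleted_eq (x : ℕ → ℕ → State nV nH) (K R : ℕ) :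
    numCompleted S x K R =
      ∑ r ∈ Finset.range R, if tourLength S (x r) ≤ K then (1 : ℝ) else 0 := by
  rw [← sum_Icc_sum_toursOfLength x K R fun _ _ => (1 : ℝ)]
  simp [numCompleted]

lemma meanTourLength_eq (x : ℕ → ℕ → State nV nH) (K R : ℕ) :
    meanTourLength S x K R = (numCompleted S x K R)⁻¹ •
      ∑ r ∈ Finset.range R,
        if tourLength S (x r) ≤ K then visitSum S (fun _ => (1 : ℝ)) (x r) else 0 := by
  have h := sum_Icc_sum_toursOfLength (S := S) x K R fun k _ => (k : ℝ)
  simp only [Finset.sum_const, nsmul_eq_mul] at h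
  rw [meanTourLength, h, div_eq_inv_mul, smul_eq_mul]
  simp [visitSum]

lemma negativeStat_eq (W : Params nV nH) (x : ℕ → ℕ → State nV nH) (K R : ℕ) :
    negativeStat W S x K R = (numCompleted S x K R)⁻¹ •
      ∑ r ∈ Finset.range R,
        if tourLength S (x r) ≤ K then visitSum S (energyGrad W) (x r) else 0 := by
  simp only [negativeStat, lengthContribution]
  rw [← Finset.smul_sum,
    sum_Icc_sum_toursOfLength x K R fun k r => ∑ i ∈ Finset.range k, energyGrad W (x r i)]
  rfl

/-- The sum of `f` over the states of a tour of length `k`, and `0` for other tours. -/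
noncomputable def visitSumOfLength {E : Type*} [AddCommMonoid E] (S : Finset (State nV nH))
    (f : State nV nH → E) (k : ℕ) (x : ℕ → State nV nH) : E :=
  if tourLength S x = k then ∑ i ∈ Finset.range k, f (x i) else 0

lemma visitSumOfLength_eq_indicator {E Ω : Type*} [AddCommMonoid E] (f : State nV nH → E)
    (k : ℕ) (X : ℕ → Ω → State nV nH) :
    (fun ω => visitSumOfLength S f k (fun t => X t ω)) =
      (lengthEvent S X k).indicator fun ω => ∑ i ∈ Finset.range k, f (X i ω) := by
  funext ω
  by_cases h : tourLength S (fun t => X t ω) = k <;>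
    simp [visitSumOfLength, lengthEvent, h]

lemma lengthContribution_eq (W : Params nV nH) (x : ℕ → ℕ → State nV nH) (K R k : ℕ) :
    lengthContribution W S x K R k = (numCompleted S x K R)⁻¹ •
      ∑ r ∈ Finset.range R, visitSumOfLength S (energyGrad W) k (x r) := by
  rw [lengthContribution, sum_toursOfLength]
  rfl

lemma measurable_visitSumOfLength {E : Type*} [NormedAddCommGroup E] [MeasurableSpace E]
    [BorelSpace E] [SecondCountableTopology E] (f : State nV nH → E) (k : ℕ) :
    Measurable (visitSumOfLength S f k) :=
  Measurable.ite (measurableSet_preimage measurable_tourLength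
      (MeasurableSet.of_discrete (s := {(k : ℕ∞)})))
    (Finset.measurable_fun_sum (Finset.range k) fun i _ =>
      (measurable_of_finite f).comp (measurable_pi_apply i)) measurable_const

/-- Ratios of sums inherit the limits of the corresponding averages. -/
lemma tendsto_inv_smul_of_average {E : Type*} [NormedAddCommGroup E] [NormedSpace ℝ E]
    {n : ℕ × ℕ → ℝ} {F : ℕ × ℕ → E} {m : E}
    (hn : Tendsto (fun q : ℕ × ℕ => (q.2 : ℝ)⁻¹ • n q) atTop (𝓝 1))
    (hF : Tendsto (fun q : ℕ × ℕ => (q.2 : ℝ)⁻¹ • F q) atTop (𝓝 m)) :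
    Tendsto (fun q => (n q)⁻¹ • F q) atTop (𝓝 m) := by
  have h := (hn.inv₀ one_ne_zero).smul hF
  rw [inv_one, one_smul] at h
  refine h.congr' ?_
  -- the factors `R⁻¹` cancel once `R ≠ 0`
  filter_upwards [eventually_ge_atTop ((0, 1) : ℕ × ℕ)] with q hq
  have hq2 : (q.2 : ℝ) ≠ 0 := by
    have : 1 ≤ q.2 := hq.2
    positivity
  rw [smul_smul]
  congr 1
  rw [smul_eq_mul]
  field_simp

end Estimator

/-! ### The contribution of the tours of one length -/

section Contribution

variable {nV nH : ℕ} {W : Params nV nH} {S : Finset (State nV nH)}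
  {P : Matrix (State nV nH) (State nV nH) ℝ} {Ω : Type*} [MeasurableSpace Ω] {μ : Measure Ω}

lemma integral_uniformOn_Iio {E : Type*} [NormedAddCommGroup E] [NormedSpace ℝ E]
    [CompleteSpace E] (k : ℕ) (f : ℕ → E) :
    ∫ i, f i ∂(uniformOn (Set.Iio k)) = (k : ℝ)⁻¹ • ∑ i ∈ Finset.range k, f i := by
  rw [uniformOn, ProbabilityTheory.cond, integral_smul_measure, ← Finset.coe_range,
    Measure.count_apply_finset, setIntegral_finset]
  · simp
  · rw [← (Finset.range k : Set ℕ).biUnion_of_singleton]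
    exact integrableOn_finset_iUnion.2 fun i _ => integrableOn_singleton (hx := by simp)

variable {X : ℕ → ℕ → Ω → State nV nH}

lemma AreTours.measurable_path (hX : AreTours μ W S P X) (r : ℕ) :
    Measurable fun ω t => X r t ω :=
  (hX.chain r).measurable_path

/-- The number of the first `R` tours, other than tour `r`, that have length at most `K`. -/
noncomputable def numOthersCompleted (S : Finset (State nV nH)) (x : ℕ → ℕ → State nV nH)
    (K R r : ℕ) : ℝ :=
  ∑ s ∈ (Finset.range R).erase r, if tourLength S (x s) ≤ K then (1 : ℝ) else 0

lemma numOthersCompleted_nonneg (x : ℕ → ℕ → State nV nH) (K R r : ℕ) :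
    0 ≤ numOthersCompleted S x K R r :=
  Finset.sum_nonneg fun s _ => by split_ifs <;> simp

lemma numOthersCompleted_le (x : ℕ → ℕ → State nV nH) (K R r : ℕ) :
    numOthersCompleted S x K R r ≤ R := by
  calc numOthersCompleted S x K R r
      ≤ ∑ s ∈ (Finset.range R).erase r, (1 : ℝ) :=
        Finset.sum_le_sum fun s _ => by split_ifs <;> simp
    _ ≤ R := by
        rw [Finset.sum_const, nsmul_eq_mul, mul_one]
        exact_mod_cast (Finset.card_erase_le).trans (Finset.card_range R).le

/-- In the contribution of the length `k ≤ K`, the number of completed tours can be replaced,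
separately for each tour of length `k`, by one plus the number of other completed tours. -/
lemma lengthContribution_eq_sum (x : ℕ → ℕ → State nV nH) {K k : ℕ} (hk : k ≤ K) (R : ℕ) :
    lengthContribution W S x K R k = ∑ r ∈ Finset.range R,
      (1 + numOthersCompleted S x K R r)⁻¹ • visitSumOfLength S (energyGrad W) k (x r) := by
  rw [lengthContribution_eq, Finset.smul_sum]
  refine Finset.sum_congr rfl fun r hr => ?_
  by_cases h : tourLength S (x r) = k
  · have hle : tourLength S (x r) ≤ K := by
      rw [h]
      exact_mod_cast hk
    rw [numCompleted_eq, ← Finset.add_sum_erase _ _ hr, if_pos hle, numOthersCompleted]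
  · simp [visitSumOfLength, h]

lemma measurable_ite_tourLength_le (K : ℕ) :
    Measurable fun x : ℕ → State nV nH => if tourLength S x ≤ K then (1 : ℝ) else 0 :=
  Measurable.ite (measurableSet_preimage measurable_tourLength
    (MeasurableSet.of_discrete (s := Set.Iic (K : ℕ∞)))) measurable_const measurable_const

/-- The other tours are independent of tour `r`. -/
lemma AreTours.indepFun_inv (hX : AreTours μ W S P X) (K R r k : ℕ) :
    IndepFun (fun ω => (1 + numOthersCompleted S (fun s t => X s t ω) K R r)⁻¹)
      (fun ω => visitSumOfLength S (energyGrad W) k (fun t => X r t ω)) μ := by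
  have hdisj : Disjoint ((Finset.range R).erase r) {r} := by simp
  have h := hX.indep.indepFun_finset _ _ hdisj hX.measurable_path
  have hφ : Measurable fun z : (Finset.range R).erase r → ℕ → State nV nH =>
      (1 + ∑ s, if tourLength S (z s) ≤ K then (1 : ℝ) else 0)⁻¹ :=
    Measurable.inv (measurable_const.add (Finset.measurable_fun_sum _ fun s _ =>
      (measurable_ite_tourLength_le K).comp (measurable_pi_apply s)))
  have hψ : Measurable fun z : ({r} : Finset ℕ) → ℕ → State nV nH =>
      visitSumOfLength S (energyGrad W) k (z ⟨r, by simp⟩) :=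
    (measurable_visitSumOfLength _ k).comp (measurable_pi_apply _)
  have h' := h.comp hφ hψ
  have e : (fun ω => (1 + numOthersCompleted S (fun s t => X s t ω) K R r)⁻¹) =
      (fun z : (Finset.range R).erase r → ℕ → State nV nH =>
        (1 + ∑ s, if tourLength S (z s) ≤ K then (1 : ℝ) else 0)⁻¹) ∘
      (fun ω (s : (Finset.range R).erase r) t => X s t ω) := by
    funext ω
    simp only [numOthersCompleted, Function.comp_apply]
    rw [← Finset.sum_coe_sort]
  rw [e]
  exact h'

variable [IsProbabilityMeasure μ]

lemma IsMarkovChain.integrable_visitSumOfLength {E : Type*} [NormedAddCommGroup E]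
    {X : ℕ → Ω → State nV nH} (hX : IsMarkovChain μ (startProb W S) P X)
    (f : State nV nH → E) (k : ℕ) :
    Integrable (fun ω => visitSumOfLength S f k (fun t => X t ω)) μ := by
  have h : ∀ i, Integrable (fun ω => f (X i ω)) μ := fun i =>
    (Integrable.of_finite (μ := μ.map (X i))).comp_measurable (hX.measurable i)
  rw [visitSumOfLength_eq_indicator]
  exact (integrable_finsetSum (Finset.range k) fun i _ => h i).indicator
    (hX.measurableSet_lengthEvent k)

/-- The weight of the length `k` is the expected sum of the energy gradients over a tour,
restricted to the tours of length `k`. -/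
lemma IsMarkovChain.tourWeight_eq {X : ℕ → Ω → State nV nH}
    (hX : IsMarkovChain μ (startProb W S) P X) {k : ℕ} (hk : 1 ≤ k) :
    tourWeight μ W S X k =
      ∫ ω, visitSumOfLength S (energyGrad W) k (fun t => X t ω) ∂μ := by
  have hA := hX.measurableSet_lengthEvent k
  rw [visitSumOfLength_eq_indicator, integral_indicator hA, tourWeight]
  -- for a null event the conditional measure is `0`, and both sides vanish
  by_cases h0 : μ (lengthEvent S X k) = 0
  · rw [Measure.restrict_eq_zero.2 h0]
    simp [measureReal_def, h0]
  have hkne : (Set.Iio k).Nonempty := ⟨0, hk⟩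
  have : IsProbabilityMeasure (cond μ (lengthEvent S X k)) := cond_isProbabilityMeasure h0
  have : IsProbabilityMeasure (uniformOn (Set.Iio k)) :=
    isProbabilityMeasure_uniformOn (Set.finite_Iio k) hkne
  have hm : Measurable fun q : Ω × ℕ => X q.2 q.1 :=
    measurable_from_prod_countable_left fun i => hX.measurable i
  have hint : Integrable (fun q : Ω × ℕ => energyGrad W (X q.2 q.1))
      ((cond μ (lengthEvent S X k)).prod (uniformOn (Set.Iio k))) := by
    have : IsFiniteMeasure (((cond μ (lengthEvent S X k)).prod (uniformOn (Set.Iio k))).map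
      fun q : Ω × ℕ => X q.2 q.1) := inferInstance
    exact (Integrable.of_finite (f := energyGrad W)).comp_measurable hm
  rw [tourStateLaw, integral_map hm.aemeasurable
    (measurable_of_finite _).aestronglyMeasurable, integral_prod _ hint]
  simp only [integral_uniformOn_Iio]
  rw [ProbabilityTheory.cond, integral_smul_measure, integral_smul, smul_smul, smul_smul,
    ENNReal.toReal_inv, ← measureReal_def]
  have h1 : μ.real (lengthEvent S X k) ≠ 0 := by
    rw [measureReal_def]
    exact ENNReal.toReal_ne_zero.2 ⟨h0, measure_ne_top _ _⟩
  have h2 : (k : ℝ) ≠ 0 := by positivity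
  have h3 : μ.real (lengthEvent S X k) * k * ((μ.real (lengthEvent S X k))⁻¹ * (k : ℝ)⁻¹) = 1 := by
    field_simp
  rw [← mul_assoc] at h3
  simp only [mul_assoc] at h3 ⊢
  rw [h3, one_smul]

lemma AreTours.identDistrib (hX : AreTours μ W S P X) (r s : ℕ) :
    IdentDistrib (fun ω t => X r t ω) (fun ω t => X s t ω) μ μ :=
  (hX.chain r).identDistrib (hX.chain s)

lemma AreTours.tourWeight_eq (hX : AreTours μ W S P X) (r s : ℕ) {k : ℕ} (hk : 1 ≤ k) :
    ∫ ω, visitSumOfLength S (energyGrad W) k (fun t => X r t ω) ∂μ =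
      tourWeight μ W S (X s) k := by
  rw [(hX.chain s).tourWeight_eq hk]
  exact ((hX.identDistrib r s).comp (measurable_visitSumOfLength (energyGrad W) k)).integral_eq

lemma AreTours.integrable_inv (hX : AreTours μ W S P X) (K R r : ℕ) :
    Integrable (fun ω => (1 + numOthersCompleted S (fun s t => X s t ω) K R r)⁻¹) μ := by
  refine Integrable.of_bound (C := 1) (Measurable.aestronglyMeasurable ?_) ?_
  · refine Measurable.inv (measurable_const.add ?_)
    exact Finset.measurable_fun_sum _ fun s _ =>
      (measurable_ite_tourLength_le K).comp (hX.measurable_path s)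
  · filter_upwards with ω
    have := numOthersCompleted_nonneg (S := S) (fun s t => X s t ω) K R r
    rw [Real.norm_of_nonneg (by positivity)]
    exact inv_le_one_of_one_le₀ (by linarith)

lemma AreTours.integral_inv_pos (hX : AreTours μ W S P X) (K R r : ℕ) :
    0 < ∫ ω, (1 + numOthersCompleted S (fun s t => X s t ω) K R r)⁻¹ ∂μ := by
  have h : ∫ _ : Ω, (1 + (R : ℝ))⁻¹ ∂μ ≤
      ∫ ω, (1 + numOthersCompleted S (fun s t => X s t ω) K R r)⁻¹ ∂μ := by
    refine integral_mono (integrable_const _) (hX.integrable_inv K R r) fun ω => ?_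
    have h0 := numOthersCompleted_nonneg (S := S) (fun s t => X s t ω) K R r
    have h1 := numOthersCompleted_le (S := S) (fun s t => X s t ω) K R r
    exact inv_anti₀ (by linarith) (by linarith)
  refine lt_of_lt_of_le ?_ h
  rw [integral_const, probReal_univ, one_smul]
  positivity

/-- With `R` tours, the expected contribution of the tours of length `k` is the weight of `k`
times a factor that does not depend on `k`: the expectation of the reciprocal of one plus the
number of other completed tours, summed over the tours. -/
lemma AreTours.integral_lengthContribution (hX : AreTours μ W S P X) {K k : ℕ} (h1 : 1 ≤ k)
    (hk : k ≤ K) (R s : ℕ) :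
    Integrable (fun ω => lengthContribution W S (fun r t => X r t ω) K R k) μ ∧
    ∫ ω, lengthContribution W S (fun r t => X r t ω) K R k ∂μ =
      (∑ r ∈ Finset.range R,
        ∫ ω, (1 + numOthersCompleted S (fun s t => X s t ω) K R r)⁻¹ ∂μ) •
        tourWeight μ W S (X s) k := by
  have hint : ∀ r ∈ Finset.range R, Integrable (fun ω =>
      (1 + numOthersCompleted S (fun s t => X s t ω) K R r)⁻¹ •
        visitSumOfLength S (energyGrad W) k (fun t => X r t ω)) μ := fun r _ =>
    (hX.indepFun_inv K R r k).integrable_smul (hX.integrable_inv K R r)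
      ((hX.chain r).integrable_visitSumOfLength _ k)
  simp only [lengthContribution_eq_sum _ hk]
  refine ⟨integrable_finsetSum _ hint, ?_⟩
  rw [integral_finsetSum _ hint, Finset.sum_smul]
  refine Finset.sum_congr rfl fun r _ => ?_
  rw [(hX.indepFun_inv K R r k).integral_fun_smul_eq_smul_integral (hX.integrable_inv K R r).1
    ((hX.chain r).integrable_visitSumOfLength _ k).1, hX.tourWeight_eq r s h1]

end Contribution

/-! ### Almost sure limits -/

section Limits

variable {nV nH : ℕ} {W : Params nV nH} {S : Finset (State nV nH)}
  {P : Matrix (State nV nH) (State nV nH) ℝ} {Ω : Type*} [MeasurableSpace Ω] {μ : Measure Ω}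
  [IsProbabilityMeasure μ] {X : ℕ → ℕ → Ω → State nV nH}

lemma AreTours.tendsto_numCompleted (hX : AreTours μ W S P X) (hP : IsReversibleChain W P)
    (hS : S.Nonempty) :
    ∀ᵐ ω ∂μ, Tendsto (fun q : ℕ × ℕ =>
      (q.2 : ℝ)⁻¹ • numCompleted S (fun r t => X r t ω) q.1 q.2) atTop (𝓝 1) := by
  have h := tendsto_truncated_average (F := fun _ => (1 : ℝ)) hX.indep
    (fun r => hX.identDistrib r 0) measurable_const (integrable_const _) measurable_tourLength
    ((hX.chain 0).ae_tourLength_ne_top hP hS)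
  simpa [numCompleted_eq] using h

/-- The average of `visitSum S f` over the completed tours converges to its expectation. -/
lemma AreTours.tendsto_average_visitSum {E : Type*} [NormedAddCommGroup E] [NormedSpace ℝ E]
    [CompleteSpace E] [MeasurableSpace E] [BorelSpace E] [SecondCountableTopology E]
    (hX : AreTours μ W S P X) (hP : IsReversibleChain W P) (hS : S.Nonempty)
    (f : State nV nH → E) :
    ∀ᵐ ω ∂μ, Tendsto (fun q : ℕ × ℕ => (numCompleted S (fun r t => X r t ω) q.1 q.2)⁻¹ •
      ∑ r ∈ Finset.range q.2, if tourLength S (fun t => X r t ω) ≤ q.1 then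
        visitSum S f (fun t => X r t ω) else 0) atTop
      (𝓝 (∫ ω, visitSum S f (fun t => X 0 t ω) ∂μ)) := by
  filter_upwards [hX.tendsto_numCompleted hP hS,
    tendsto_truncated_average hX.indep (fun r => hX.identDistrib r 0) (measurable_visitSum f)
      ((hX.chain 0).integrable_visitSum hP hS f) measurable_tourLength
      ((hX.chain 0).ae_tourLength_ne_top hP hS)] with ω h1 h2
  exact tendsto_inv_smul_of_average h1 h2

lemma AreTours.tendsto_meanTourLength (hX : AreTours μ W S P X) (hP : IsReversibleChain W P)
    (hS : S.Nonempty) :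
    ∀ᵐ ω ∂μ, Tendsto (fun q : ℕ × ℕ => meanTourLength S (fun r t => X r t ω) q.1 q.2) atTop
      (𝓝 (partition W / stoppingPartition W S)) := by
  simp only [meanTourLength_eq, ← (hX.chain 0).integral_visitSum_one hP hS]
  exact hX.tendsto_average_visitSum hP hS fun _ => (1 : ℝ)

lemma AreTours.tendsto_negativeStat (hX : AreTours μ W S P X) (hP : IsReversibleChain W P)
    (hS : S.Nonempty) :
    ∀ᵐ ω ∂μ, Tendsto (fun q : ℕ × ℕ => negativeStat W S (fun r t => X r t ω) q.1 q.2) atTop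
      (𝓝 ((partition W / stoppingPartition W S) • ∑ x, prob W x • energyGrad W x)) := by
  have h : (partition W / stoppingPartition W S) • ∑ x, prob W x • energyGrad W x =
      ∫ ω, visitSum S (energyGrad W) (fun t => X 0 t ω) ∂μ := by
    rw [(hX.chain 0).integral_visitSum hP hS, Finset.smul_sum]
    refine Finset.sum_congr rfl fun x _ => ?_
    rw [smul_smul, prob, div_mul_div_comm, mul_comm (partition W),
      mul_div_mul_right _ _ (partition_pos W).ne']
  simp only [negativeStat_eq, h]
  exact hX.tendsto_average_visitSum hP hS (energyGrad W)

lemma AreTours.tendsto_lengthContribution (hX : AreTours μ W S P X)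
    (hP : IsReversibleChain W P) (hS : S.Nonempty) {k : ℕ} (hk : 1 ≤ k) (s : ℕ) :
    ∀ᵐ ω ∂μ, Tendsto
      (fun q : ℕ × ℕ => lengthContribution W S (fun r t => X r t ω) q.1 q.2 k) atTop
      (𝓝 (tourWeight μ W S (X s) k)) := by
  simp only [lengthContribution_eq, ← hX.tourWeight_eq 0 s hk]
  filter_upwards [hX.tendsto_numCompleted hP hS,
    strong_law_ae_comp hX.indep (fun r => hX.identDistrib r 0)
      (measurable_visitSumOfLength (energyGrad W) k)
      ((hX.chain 0).integrable_visitSumOfLength (energyGrad W) k)] with ω h1 h2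
  refine tendsto_inv_smul_of_average h1 (h2.comp ?_)
  rw [← prod_atTop_atTop_eq]
  exact tendsto_snd

lemma AreTours.tendsto_lvsEstimator (hX : AreTours μ W S P X) (hP : IsReversibleChain W P)
    (hS : S.Nonempty) {N : ℕ} (hN : 0 < N) (data : Fin N → Fin nV → Fin 2) (η : ℝ) :
    ∀ᵐ ω ∂μ, Tendsto
      (fun q : ℕ × ℕ => lvsEstimator η data W S (fun r t => X r t ω) q.1 q.2) atTop
      (𝓝 ((η * (partition W / stoppingPartition W S)) • gradient (negLogLik data) W)) := by
  filter_upwards [hX.tendsto_meanTourLength hP hS, hX.tendsto_negativeStat hP hS] with ω h1 h2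
  have h := (((h1.div_const (N : ℝ)).smul_const (∑ n, dataEnergyGrad W (data n))).sub
    h2).const_smul η
  rw [(hasGradientAt_negLogLik hN data W).gradient]
  rw [div_eq_mul_one_div _ (N : ℝ), mul_smul, ← smul_sub, smul_smul] at h
  exact h

/-- Exponential decay, in `k`, of the probability of a tour of length `k` times `k`. -/
lemma AreTours.exists_exponential_decay (hX : AreTours μ W S P X) (hP : IsReversibleChain W P)
    (hS : S.Nonempty) {ε : ℝ} (hε : 0 < ε) (h : ∀ x ∉ S, ε ≤ ∑ y ∈ S, P x y) :
    ∃ C c : ℝ, 0 < C ∧ 0 < c ∧ ∀ (r k : ℕ), 1 ≤ k →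
      μ.real (lengthEvent S (X r) k) * k ≤ C * Real.exp (-c * k) := by
  -- `ε` is decreased to keep the ratio `1 - ε` of the geometric bound positive
  set δ : ℝ := min ε (1 / 2)
  have hδ0 : 0 < δ := lt_min hε (by norm_num)
  have hδ1 : δ ≤ 1 / 2 := min_le_right _ _
  have hρ0 : 0 < 1 - δ := by linarith
  obtain ⟨C, c, hC, hc, hb⟩ := exists_mul_pow_le_exp hρ0 (by linarith : 1 - δ < 1)
  refine ⟨C / (1 - δ) ^ 2, c, by positivity, hc, fun r k hk => ?_⟩
  have hp : μ.real (lengthEvent S (X r) k) ≤ (1 - δ) ^ k / (1 - δ) ^ 2 := by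
    rw [le_div_iff₀ (by positivity)]
    obtain rfl | ⟨j, rfl⟩ : k = 1 ∨ ∃ j, k = j + 2 := by
      rcases hk.eq_or_lt with h | h
      · exact Or.inl h.symm
      · exact Or.inr ⟨k - 2, by omega⟩
    · have h1 : μ.real (lengthEvent S (X r) 1) ≤ 1 := measureReal_le_one
      nlinarith [mul_le_mul_of_nonneg_right h1 (sq_nonneg (1 - δ))]
    · rw [pow_add]
      refine mul_le_mul_of_nonneg_right ?_ (by positivity)
      exact (hX.chain r).measureReal_lengthEvent_succ_succ_le hP hS (by linarith)
        (fun x hx => (min_le_left _ _).trans (h x hx)) j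
  calc μ.real (lengthEvent S (X r) k) * k
      ≤ (1 - δ) ^ k / (1 - δ) ^ 2 * k := mul_le_mul_of_nonneg_right hp (Nat.cast_nonneg k)
    _ = (k * (1 - δ) ^ k) / (1 - δ) ^ 2 := by ring
    _ ≤ C * Real.exp (-c * k) / (1 - δ) ^ 2 :=
        div_le_div_of_nonneg_right (hb k) (by positivity)
    _ = C / (1 - δ) ^ 2 * Real.exp (-c * k) := by ring

end Limits

end RBM

/-! ### Consistency and rates of the estimator -/

theorem mainTheorem6 {nV nH N : ℕ} (hN : 0 < N) (data : Fin N → Fin nV → Fin 2)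
    (W : Params nV nH) (P : Matrix (State nV nH) (State nV nH) ℝ) (hP : IsReversibleChain W P)
    (S : Finset (State nV nH)) (hS : S.Nonempty) (hS' : S ≠ Finset.univ)
    (η : ℝ) (hη : 0 < η)
    {Ω : Type*} [MeasurableSpace Ω] (μ : Measure Ω) [IsProbabilityMeasure μ]
    (X : ℕ → ℕ → Ω → State nV nH) (hX : AreTours μ W S P X) :
    -- consistency, up to the positive scaling `Z / Z_S`, jointly in `(K, R)`
    DifferentiableAt ℝ (negLogLik data) W ∧
    (∀ᵐ ω ∂μ, Tendsto
      (fun q : ℕ × ℕ => lvsEstimator η data W S (fun r t => X r t ω) q.1 q.2) atTop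
      (𝓝 ((η * (partition W / stoppingPartition W S)) • gradient (negLogLik data) W))) ∧
    -- consistency after division by the empirical mean tour length
    (∀ᵐ ω ∂μ, Tendsto
      (fun q : ℕ × ℕ => (meanTourLength S (fun r t => X r t ω) q.1 q.2)⁻¹ •
        lvsEstimator η data W S (fun r t => X r t ω) q.1 q.2) atTop
      (𝓝 (η • gradient (negLogLik data) W))) ∧
    -- expected contribution of the tours of length `k`, with finitely many tours
    (∀ K R : ℕ, 1 ≤ K → 1 ≤ R → ∃ c : ℝ, 0 < c ∧ ∀ k ∈ Finset.Icc 1 K, ∀ r,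
      Integrable (fun ω => lengthContribution W S (fun r t => X r t ω) K R k) μ ∧
      ∫ ω, lengthContribution W S (fun r t => X r t ω) K R k ∂μ =
        c • tourWeight μ W S (X r) k) ∧
    -- and its limit
    (∀ k : ℕ, 1 ≤ k → ∀ r, ∀ᵐ ω ∂μ, Tendsto
      (fun q : ℕ × ℕ => lengthContribution W S (fun r t => X r t ω) q.1 q.2 k) atTop
      (𝓝 (tourWeight μ W S (X r) k))) ∧
    -- exponential decay of the weights
    ((∃ ε : ℝ, 0 < ε ∧ ∀ x ∉ S, ε ≤ ∑ y ∈ S, P x y) →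
      ∃ C c : ℝ, 0 < C ∧ 0 < c ∧ ∀ (r k : ℕ), 1 ≤ k →
        μ.real (lengthEvent S (X r) k) * k ≤ C * Real.exp (-c * k)) := by
  refine ⟨(hasGradientAt_negLogLik hN data W).differentiableAt,
    hX.tendsto_lvsEstimator hP hS hN data η, ?_, ?_,
    fun k hk r => hX.tendsto_lengthContribution hP hS hk r, ?_⟩
  · have hρ : partition W / stoppingPartition W S ≠ 0 :=
      (div_pos (partition_pos W) (stoppingPartition_pos W hS)).ne'
    filter_upwards [hX.tendsto_meanTourLength hP hS,
      hX.tendsto_lvsEstimator hP hS hN data η] with ω h1 h2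
    have h := (h1.inv₀ hρ).smul h2
    rwa [smul_smul, mul_left_comm, inv_mul_cancel₀ hρ, mul_one] at h
  · intro K R _ hR
    refine ⟨∑ r ∈ Finset.range R,
      ∫ ω, (1 + numOthersCompleted S (fun s t => X s t ω) K R r)⁻¹ ∂μ,
      Finset.sum_pos (fun r _ => hX.integral_inv_pos K R r)
        (Finset.nonempty_range_iff.2 (by omega)), fun k hk r => ?_⟩
    exact hX.integral_lengthContribution (Finset.mem_Icc.1 hk).1 (Finset.mem_Icc.1 hk).2 R r
  · rintro ⟨ε, hε, h⟩
    exact hX.exists_exponential_decay hP hS hε h
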